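/- Let $p$ be a prime, $m\ge 1$ and $s\ge 1$ integers, and $N=p^m$. Let $1\ge\gamma_1\ge\gamma_2\ge\cdots$ be positive real numbers, let $\gamma_{\mathfrak u}=\prod_{j\in\mathfrak u}\gamma_j$ for $\mathfrak u\subseteq[s]=\{1,\dots,s\}$, and let $0=w_1\le w_2\le\cdots$ be integers. *Discrepancy.* For points $\mathcal P=(\boldsymbol x_0,\dots,\boldsymbol x_{N-1})$ in $[0,1)^s$ and $\boldsymbol t\in(0,1]^s$ put $\Delta(\boldsymbol t,\mathcal P)=\frac1N\#\{n:\boldsymbol x_n\in\prod_j[0,t_j)\}-\prod_j t_j$. The weighted star discrepancy is $$D^*_{N,\gamma}(\mathcal P)=\sup_{\boldsymbol t\in(0,1]^s}\max_{\emptyset\ne\mathfrak u\subseteq[s]}\gamma_{\mathfrak u}|\Delta((\boldsymbol t_{\mathfrak u},\boldsymbol 1),\mathcal P)|,$$ where $(\boldsymbol t_{\mathfrak u},\boldsymbol 1)$ has $j$-th coordinate $t_j$ if $j\in\mathfrak u$ and $1$ otherwise. *Polynomial lattice points.* Identify $\mathbb F_p$ with $\{0,\dots,p-1\}$ and define $\phi_m:\mathbb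 F_p((x^{-1}))\to[0,1)$ by $\phi_m(\sum_l t_lx^{-l})=\sum_{l=1}^m t_lp^{-l}$. For $0\le n<p^m$ with base-$p$ digits $n_0,\dots,n_{m-1}$ let $n(x)=\sum_{r<m}n_rx^r$. For $f\in\mathbb F_p[x]$ of degree $m$ and $\boldsymbol g\in\mathbb F_p[x]^s$, $\mathcal P(\boldsymbol g,f)$ consists of the points $\boldsymbol x_n=(\phi_m(n g_1/f),\dots,\phi_m(n g_s/f))$, $0\le n<p^m$; write $D^*_{N,\gamma}(\boldsymbol g,f)$ for its weighted star discrepancy. *Reduced component-by-component construction, for the modulus $f=x^m$.* Let $G_{p,m}$ be the set of polynomials over $\mathbb F_p$ of degree $<m$. Let $\mathcal G_{p,m-w}$ be the set of $g\in\mathbb F_p[x]$ with $\deg g<m-w$ and $\gcd(g,x^m)=1$ if $w<m$, and $\{1\}$ if $w\ge m$. For $0\neq h\in G_{p,m}$ of degree $a$ with leading coefficient $h_a$ put $r_p(h)=p^{-a-1}\sin^{-2}(\pi h_a/p)$; put $r_p(0,\gamma)=1+\gamma$ and $r_p(h,\gamma)=\gamma r_p(h)$ for $h\ne0$. For $\boldsymbol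 g\in\mathbb F_p[x]^d$ let $$R^d_\gamma(\boldsymbol g)=\sum_{\boldsymbol h}\prod_{i=1}^d r_p(h_i,\gamma_i),$$ the sum being over all $\boldsymbol h\in G_{p,m}^d\setminus\{\boldsymbol 0\}$ with $h_1g_1+\dots+h_dg_d\equiv0\pmod{x^m}$. Suppose that $g_1=1$ and that, for $d=1,\dots,s-1$, $g_{d+1}$ is an element of $\mathcal G_{p,m-w_{d+1}}$ that minimizes $g\mapsto R^{d+1}_\gamma(x^{w_1}g_1,\dots,x^{w_d}g_d,x^{w_{d+1}}g)$ over $\mathcal G_{p,m-w_{d+1}}$. *Claim.* $$D^*_{N,\gamma}\big((x^{w_1}g_1,\dots,x^{w_s}g_s),x^m\big)\le\sum_{\emptyset\ne\mathfrak u\subseteq[s]}\gamma_{\mathfrak u}\Big(1-\Big(1-\frac1N\Big)^{|\mathfrak u|}\Big)+\frac1N\prod_{i=1}^s\Big(1+\gamma_i+2\gamma_i\,p^{\min\{w_i,m\}}\,m\,\frac{p^2-1}{3p}\Big).$$ -/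

import Mathlib

namespace PolyLattice

noncomputable section

open Polynomial

/-! ### Weighted star discrepancy

Coordinates are indexed by `Fin s = {0, …, s-1}`, and sequences `(a_j)_{j ≥ 1}` by `ℕ` starting
at `0`: the Lean value `a j` is the `(j+1)`-st member of the sequence. -/

/-- Local discrepancy `Δ(t, P)` of the points `x_0, …, x_{N-1}` (counted with multiplicity). -/
def localDiscrepancy {N s : ℕ} (x : Fin N → Fin s → ℝ) (t : Fin s → ℝ) : ℝ :=
  (1 / (N : ℝ)) * ∑ n, Set.indicator {y : Fin s → ℝ | ∀ j, 0 ≤ y j ∧ y j < t j} (fun _ => (1 : ℝ)) (x n)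
    - ∏ j, t j

/-- The vector `(t_u, 1)`: `t_j` for `j ∈ u` and `1` otherwise. -/
def fillOnes {s : ℕ} (u : Finset (Fin s)) (t : Fin s → ℝ) : Fin s → ℝ :=
  fun j => if j ∈ u then t j else 1

/-- The values `γ_u |Δ((t_u, 1), P)|` for `t ∈ (0,1]^s` and nonempty `u`. -/
def weightedLocalValues {N s : ℕ} (γ : Finset (Fin s) → ℝ) (x : Fin N → Fin s → ℝ) : Set ℝ :=
  {v | ∃ t : Fin s → ℝ, (∀ j, 0 < t j ∧ t j ≤ 1) ∧ ∃ u : Finset (Fin s), u.Nonempty ∧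
    v = γ u * |localDiscrepancy x (fillOnes u t)|}

/-- Weighted star discrepancy: the supremum over `t ∈ (0,1]^s` of the maximum over nonempty `u`
of `γ_u |Δ((t_u, 1), P)|`. -/
def weightedStarDiscrepancy {N s : ℕ} (γ : Finset (Fin s) → ℝ) (x : Fin N → Fin s → ℝ) : ℝ :=
  sSup (weightedLocalValues γ x)

/-- Product weights `γ_u = ∏_{j ∈ u} γ_j`. -/
def productWeight {s : ℕ} (γ : ℕ → ℝ) (u : Finset (Fin s)) : ℝ :=
  ∏ j ∈ u, γ j

lemma abs_localDiscrepancy_le {N s : ℕ} (x : Fin N → Fin s → ℝ) (t : Fin s → ℝ)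
    (ht : ∀ j, 0 < t j ∧ t j ≤ 1) : |localDiscrepancy x t| ≤ 1 := by
  have h1 : 0 ≤ ∏ j, t j := Finset.prod_nonneg fun j _ => (ht j).1.le
  have h2 : ∏ j, t j ≤ 1 := Finset.prod_le_one (fun j _ => (ht j).1.le) fun j _ => (ht j).2
  set S : ℝ := ∑ n, Set.indicator {y : Fin s → ℝ | ∀ j, 0 ≤ y j ∧ y j < t j}
    (fun _ => (1 : ℝ)) (x n) with hS
  have h3 : 0 ≤ S := Finset.sum_nonneg fun n _ => Set.indicator_nonneg (fun _ _ => zero_le_one) _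
  have h4 : S ≤ N := by
    have : S ≤ ∑ _n : Fin N, (1 : ℝ) :=
      Finset.sum_le_sum fun n _ => Set.indicator_le_self' (fun _ _ => zero_le_one) _
    simpa using this
  have h5 : 0 ≤ (1 / (N : ℝ)) * S := by positivity
  have h6 : (1 / (N : ℝ)) * S ≤ 1 := by
    rw [one_div, inv_mul_eq_div]
    exact div_le_one_of_le₀ h4 (Nat.cast_nonneg N)
  have h7 : localDiscrepancy x t = (1 / (N : ℝ)) * S - ∏ j, t j := rfl
  rw [h7, abs_le]
  constructor <;> linarith

/-- The supremum that defines the weighted star discrepancy is always finite. -/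
lemma bddAbove_weightedLocalValues {N s : ℕ} (γ : Finset (Fin s) → ℝ) (x : Fin N → Fin s → ℝ) :
    BddAbove (weightedLocalValues γ x) := by
  refine ⟨∑ u, |γ u|, ?_⟩
  rintro v ⟨t, ht, u, -, rfl⟩
  have h : |localDiscrepancy x (fillOnes u t)| ≤ 1 := by
    refine abs_localDiscrepancy_le x _ fun j => ?_
    unfold fillOnes
    split_ifs
    · exact ht j
    · norm_num
  calc γ u * |localDiscrepancy x (fillOnes u t)|
      ≤ |γ u| * 1 := mul_le_mul (le_abs_self _) h (abs_nonneg _) (abs_nonneg _)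
    _ = |γ u| := mul_one _
    _ ≤ ∑ u, |γ u| :=
        Finset.single_le_sum (f := fun u => |γ u|) (fun _ _ => abs_nonneg _) (Finset.mem_univ u)

/-! ### Polynomial lattice point sets -/

section

variable (p : ℕ) [Fact p.Prime]

/-- The embedding `F_p[x] → F_p((x⁻¹))`. The field `F_p((x⁻¹))` is the Laurent series field in the
variable `x⁻¹`, so the coefficient at index `l` belongs to `x^{-l}`, and the polynomial variable
is sent to the series with the single coefficient `1` at index `-1`. -/
def laurentAtInfty : (ZMod p)[X] →ₐ[ZMod p] LaurentSeries (ZMod p) :=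
  aeval (HahnSeries.single (-1 : ℤ) (1 : ZMod p) : LaurentSeries (ZMod p))

/-- `φ_m (∑_l t_l x^{-l}) = ∑_{l=1}^m t_l p^{-l}`, where `t_l ∈ {0, …, p-1}`. -/
def phi (m : ℕ) (L : LaurentSeries (ZMod p)) : ℝ :=
  ∑ l ∈ Finset.Icc 1 m, ((L.coeff (l : ℤ)).val : ℝ) / (p : ℝ) ^ l

/-- The polynomial `n(x) = ∑_{r<m} n_r x^r`, with `n_r` the base-`p` digits of `n`. -/
def digitPoly (m n : ℕ) : (ZMod p)[X] :=
  ∑ r ∈ Finset.range m, C ((n / p ^ r % p : ℕ) : ZMod p) * X ^ r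

/-- The polynomial lattice point set `P(g, f)`, with `deg f = m`: the points
`x_n = (φ_m(n g_1 / f), …, φ_m(n g_s / f))` for `0 ≤ n < p^m`. -/
def latticePoints (m : ℕ) {s : ℕ} (g : Fin s → (ZMod p)[X]) (f : (ZMod p)[X]) :
    Fin (p ^ m) → Fin s → ℝ :=
  fun n i => phi p m (laurentAtInfty p (digitPoly p m n * g i) / laurentAtInfty p f)

/-! ### The reduced component-by-component construction -/

lemma finite_degree_lt (m : ℕ) : {h : (ZMod p)[X] | h.degree < m}.Finite := by
  have e := (Polynomial.degreeLTEquiv (ZMod p) m).toEquiv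
  have : Finite (Polynomial.degreeLT (ZMod p) m) := Finite.of_equiv _ e.symm
  refine Set.Finite.subset (Set.toFinite ((Polynomial.degreeLT (ZMod p) m : Set (ZMod p)[X]))) ?_
  intro h hh
  exact Polynomial.mem_degreeLT.2 hh

/-- `G_{p,m}`: the polynomials over `F_p` of degree `< m` (the zero polynomial included). -/
def polysLT (m : ℕ) : Finset (ZMod p)[X] := (finite_degree_lt p m).toFinset

/-- The search set: the `g` with `deg g < m - w` and `gcd(g, f) = 1` if `w < m`, and `{1}` if
`w ≥ m`. -/
def searchSet (m w : ℕ) (f : (ZMod p)[X]) : Set (ZMod p)[X] :=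
  if w < m then {g | g ∈ polysLT p (m - w) ∧ IsCoprime g f} else {1}

/-- `r_p(h) = 1 / (p^{a+1} sin²(π h_a / p))` for `h ≠ 0` of degree `a` with leading
coefficient `h_a ∈ {1, …, p-1}`. -/
def rp (h : (ZMod p)[X]) : ℝ :=
  1 / ((p : ℝ) ^ (h.natDegree + 1) * Real.sin (Real.pi / p * (h.leadingCoeff.val : ℝ)) ^ 2)

open Classical in
/-- `r_p(h, γ)`, equal to `1 + γ` for `h = 0` and to `γ r_p(h)` otherwise. -/
def rpWeighted (h : (ZMod p)[X]) (γ : ℝ) : ℝ :=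
  if h = 0 then 1 + γ else γ * rp p h

open Classical in
/-- The quantity `R^d_γ(g, f)`: the sum of `∏_i r_p(h_i, γ_i)` over all nonzero `h ∈ G_{p,m}^d`
with `h · g ≡ 0 (mod f)`. -/
def figureR (m : ℕ) (γ : ℕ → ℝ) {d : ℕ} (g : Fin d → (ZMod p)[X]) (f : (ZMod p)[X]) : ℝ :=
  ∑ h ∈ (Fintype.piFinset fun _ : Fin d => polysLT p m) with h ≠ 0 ∧ f ∣ ∑ i, h i * g i,
    ∏ i, rpWeighted p (h i) (γ i)

/-- The generating vector `(x^{w_1} g_1, …, x^{w_s} g_s)`. -/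
def shiftedVector (w : ℕ → ℕ) {s : ℕ} (g : Fin s → (ZMod p)[X]) : Fin s → (ZMod p)[X] :=
  fun i : Fin s => X ^ w (i : ℕ) * g i

/-- `(g_1, …, g_s)` is a possible output of the reduced component-by-component algorithm: each
component lies in its search set, the first one is `1`, and each later one minimizes `R` of the
vector formed by the previous components and itself, over its search set. -/
structure IsReducedCBC (m : ℕ) (f : (ZMod p)[X]) (w : ℕ → ℕ) (γ : ℕ → ℝ) {s : ℕ}
    (g : Fin s → (ZMod p)[X]) : Prop where
  mem_searchSet : ∀ i : Fin s, g i ∈ searchSet p m (w i) f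
  first_eq_one : ∀ i : Fin s, (i : ℕ) = 0 → g i = 1
  minimal : ∀ (d : ℕ) (hd : d < s), 1 ≤ d → ∀ q ∈ searchSet p m (w d) f,
    figureR p m γ (Fin.take (d + 1) hd (shiftedVector p w g)) f ≤
      figureR p m γ (Fin.take (d + 1) hd (shiftedVector p w (Function.update g ⟨d, hd⟩ q))) f

end

end

end PolyLattice

/-!
The indicator function of a box `∏ j, [0, k j / p ^ m)` is a function of the `p`-adic digits of a
point, and averaging its Fourier expansion over a polynomial lattice keeps only the frequencies in
the dual net. The frequency `0` contributes the volume of the box, and the coefficient at `h ≠ 0`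
is at most `r_p h`, because such a box is, digit by digit, made of geometric sums. Thus `R` bounds
the weighted discrepancy of grid boxes for every modulus of degree `m`, and rounding the corner of
an arbitrary box up to the grid costs the first sum in the claim.

For the modulus `X ^ m`, a minimizer of `R` over a search set is at most the average over it. The
average comes down to counting the units `q` with `X ^ n ∣ c + b q`: if `X ^ e = gcd(c, X ^ n)`,
there are at most `p ^ e` of them, and none unless `X ^ e ∣ b`. As
`r_p (X ^ e * b) = r_p b / p ^ e`, the total weight of all solutions is at most `∑ b, r_p b`, which
the identity `∑ 0 < b < p, 1 / sin² (π b / p) = (p² - 1) / 3` evaluates. -/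

namespace PolyLattice

open Polynomial

section AdditiveCharacters

theorem addChar_sum_eq_prod {ι A M : Type*} [AddCommMonoid A] [CommMonoid M] (ψ : AddChar A M)
    (s : Finset ι) (x : ι → A) : ψ (∑ i ∈ s, x i) = ∏ i ∈ s, ψ (x i) :=
  map_prod ψ.toMonoidHom (fun i => Multiplicative.ofAdd (x i)) s

variable {R : Type*} [CommRing R] [Fintype R]

theorem sum_norm_sq_sum_mul_addChar {ψ : AddChar R ℂ} (hψ : ψ.IsPrimitive) (f : R → ℂ) :
    ∑ k, ‖∑ j, f j * ψ (j * k)‖ ^ 2 = Fintype.card R * ∑ j, ‖f j‖ ^ 2 := by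
  classical
  have orthogonality (i j : R) :
      ∑ k, ψ (i * k) * ψ (-(j * k)) = if i = j then (Fintype.card R : ℂ) else 0 := by
    simp_rw [← AddChar.map_add_eq_mul, ← sub_eq_add_neg, ← sub_mul, mul_comm (i - j),
      AddChar.sum_mulShift _ hψ, sub_eq_zero]
    split_ifs <;> simp
  rw [← Complex.ofReal_inj]
  push_cast
  calc ∑ k, (‖∑ j, f j * ψ (j * k)‖ : ℂ) ^ 2
      = ∑ k, ∑ i, ∑ j, f i * starRingEnd ℂ (f j) * (ψ (i * k) * ψ (-(j * k))) := by
        simp_rw [← Complex.mul_conj', map_sum, map_mul, ← AddChar.map_neg_eq_conj,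
          Finset.sum_mul_sum, mul_mul_mul_comm]
    _ = ∑ i, ∑ j, f i * starRingEnd ℂ (f j) * if i = j then (Fintype.card R : ℂ) else 0 := by
        simp_rw [← orthogonality, Finset.mul_sum]
        rw [Finset.sum_comm]
        exact Finset.sum_congr rfl fun i _ => Finset.sum_comm
    _ = Fintype.card R * ∑ j, (‖f j‖ : ℂ) ^ 2 := by
        simp [Complex.mul_conj', Finset.mul_sum, mul_comm]

theorem sum_addChar_dotProduct {ι : Type*} [Fintype ι] [DecidableEq ι] [DecidableEq R]
    {ψ : AddChar R ℂ} (hψ : ψ.IsPrimitive) (h : ι → R) :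
    ∑ a : ι → R, ψ (a ⬝ᵥ h) = if h = 0 then (Fintype.card R : ℂ) ^ Fintype.card ι else 0 := by
  simp_rw [dotProduct, addChar_sum_eq_prod]
  rw [← Fintype.prod_sum fun (i : ι) (b : R) => ψ (b * h i)]
  simp_rw [AddChar.sum_mulShift _ hψ]
  split_ifs with h0
  · simp [h0]
  · obtain ⟨i, hi⟩ := Function.ne_iff.1 h0
    exact Finset.prod_eq_zero (Finset.mem_univ i) (by simpa using hi)

end AdditiveCharacters

section CosecantSum

variable {n : ℕ} [NeZero n]

theorem sum_zmod_val {M : Type*} [AddCommMonoid M] (F : ℕ → M) :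
    ∑ j : ZMod n, F j.val = ∑ j ∈ Finset.range n, F j := by
  obtain _ | k := n
  · exact absurd rfl (NeZero.ne 0)
  · exact Fin.sum_univ_eq_sum_range F (k + 1)

theorem stdAddChar_mul_eq_pow (j k : ZMod n) :
    ZMod.stdAddChar (j * k) = (ZMod.stdAddChar k : ℂ) ^ j.val := by
  rw [← AddChar.map_nsmul_eq_pow, nsmul_eq_mul, ZMod.natCast_zmod_val]

theorem stdAddChar_pow_card (k : ZMod n) : (ZMod.stdAddChar k : ℂ) ^ n = 1 := by
  rw [← AddChar.map_nsmul_eq_pow, nsmul_eq_mul, ZMod.natCast_self, zero_mul,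
    AddChar.map_zero_eq_one]

theorem stdAddChar_ne_one {k : ZMod n} (hk : k ≠ 0) : (ZMod.stdAddChar k : ℂ) ≠ 1 := by
  rw [← AddChar.map_zero_eq_one (ZMod.stdAddChar (N := n))]
  exact ZMod.injective_stdAddChar.ne hk

theorem norm_stdAddChar_sub_one (k : ZMod n) :
    ‖(ZMod.stdAddChar k : ℂ) - 1‖ = 2 * |Real.sin (Real.pi / n * k.val)| := by
  have exp_form : (ZMod.stdAddChar k : ℂ) =
      Complex.exp (Complex.I * ((2 * (Real.pi / n * k.val) : ℝ) : ℂ)) := by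
    conv_lhs => rw [← ZMod.natCast_zmod_val k, ← Int.cast_natCast, ZMod.stdAddChar_coe]
    push_cast
    ring_nf
  rw [exp_form, Complex.norm_exp_I_mul_ofReal_sub_one, mul_div_cancel_left₀ _ two_ne_zero,
    norm_mul, Real.norm_eq_abs, Real.norm_eq_abs, abs_two]

theorem sin_pi_div_mul_val_ne_zero {k : ZMod n} (hk : k ≠ 0) :
    Real.sin (Real.pi / n * k.val) ≠ 0 := fun h => by
  have := norm_stdAddChar_sub_one k
  rw [h, abs_zero, mul_zero, norm_eq_zero, sub_eq_zero] at this
  exact stdAddChar_ne_one hk this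

theorem sub_one_mul_sum_mul_pow {A : Type*} [CommRing A] (z : A) (n : ℕ) :
    (z - 1) * ∑ j ∈ Finset.range n, (j : A) * z ^ j =
      n * z ^ n - z * ∑ j ∈ Finset.range n, z ^ j := by
  induction n with
  | zero => simp
  | succ k ih =>
    rw [Finset.sum_range_succ, Finset.sum_range_succ, mul_add, mul_add, ih]
    push_cast
    ring

theorem stdAddChar_sub_one_mul_sum_val {k : ZMod n} (hk : k ≠ 0) :
    ((ZMod.stdAddChar k : ℂ) - 1) * ∑ j : ZMod n, (j.val : ℂ) * ZMod.stdAddChar (j * k) = n := by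
  have geom_sum_zero : ∑ j ∈ Finset.range n, (ZMod.stdAddChar k : ℂ) ^ j = 0 := by
    rw [geom_sum_eq (stdAddChar_ne_one hk), stdAddChar_pow_card, sub_self, zero_div]
  simp_rw [stdAddChar_mul_eq_pow]
  rw [sum_zmod_val fun j => (j : ℂ) * ZMod.stdAddChar k ^ j, sub_one_mul_sum_mul_pow,
    stdAddChar_pow_card, geom_sum_zero, mul_one, mul_zero, sub_zero]

theorem norm_sq_sum_val_mul_stdAddChar {k : ZMod n} (hk : k ≠ 0) :
    ‖∑ j : ZMod n, (j.val : ℂ) * ZMod.stdAddChar (j * k)‖ ^ 2 =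
      (n : ℝ) ^ 2 / 4 * (1 / Real.sin (Real.pi / n * k.val) ^ 2) := by
  have hnorm := congrArg (‖·‖ ^ 2) (stdAddChar_sub_one_mul_sum_val hk)
  simp only [norm_mul, norm_stdAddChar_sub_one, mul_pow, sq_abs, Complex.norm_natCast] at hnorm
  have hsin := sin_pi_div_mul_val_ne_zero hk
  rw [mul_one_div, eq_div_iff (pow_ne_zero 2 hsin)]
  linarith

theorem sum_range_cast (n : ℕ) : ∑ j ∈ Finset.range n, (j : ℝ) = n * (n - 1) / 2 := by
  induction n with
  | zero => simp
  | succ k ih => rw [Finset.sum_range_succ, ih]; push_cast; ring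

theorem sum_range_cast_sq (n : ℕ) :
    ∑ j ∈ Finset.range n, (j : ℝ) ^ 2 = n * (n - 1) * (2 * n - 1) / 6 := by
  induction n with
  | zero => simp
  | succ k ih => rw [Finset.sum_range_succ, ih]; push_cast; ring

/- Parseval for the function `j ↦ j` on `ZMod n`, whose transform at `k ≠ 0` is
`n / (χ(k) - 1)`. -/
theorem sum_one_div_sin_sq (n : ℕ) [NeZero n] :
    ∑ k ∈ Finset.univ.erase (0 : ZMod n), 1 / Real.sin (Real.pi / n * k.val) ^ 2 =
      ((n : ℝ) ^ 2 - 1) / 3 := by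
  have parseval := sum_norm_sq_sum_mul_addChar (ZMod.isPrimitive_stdAddChar n) fun j => (j.val : ℂ)
  have at_zero : ‖∑ j : ZMod n, (j.val : ℂ) * ZMod.stdAddChar (j * 0)‖ = n * (n - 1) / 2 := by
    simp_rw [mul_zero, AddChar.map_zero_eq_one, mul_one, ← sum_range_cast, ← Nat.cast_sum,
      Complex.norm_natCast, sum_zmod_val (n := n) fun j => j, Nat.cast_sum]
  have energy : ∑ j : ZMod n, ‖(j.val : ℂ)‖ ^ 2 = n * (n - 1) * (2 * n - 1) / 6 := by
    simp_rw [Complex.norm_natCast, ← sum_range_cast_sq]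
    exact sum_zmod_val fun j => (j : ℝ) ^ 2
  rw [← Finset.add_sum_erase _ _ (Finset.mem_univ 0), at_zero, energy, ZMod.card, Finset.sum_congr
    rfl fun k hk => norm_sq_sum_val_mul_stdAddChar (Finset.ne_of_mem_erase hk), ← Finset.mul_sum]
    at parseval
  have hn : (n : ℝ) ^ 2 ≠ 0 := pow_ne_zero 2 (NeZero.ne _)
  apply mul_left_cancel₀ hn
  linarith

end CosecantSum

section Fourier

variable {R ι : Type*} [CommRing R] [Fintype R] [Fintype ι] [DecidableEq ι]

theorem fourier_inversion {ψ : AddChar R ℂ} (hψ : ψ.IsPrimitive) (f : (ι → R) → ℂ) (a : ι → R) :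
    f a = ∑ h, ((Fintype.card R : ℂ) ^ Fintype.card ι)⁻¹ * (∑ b, f b * ψ (b ⬝ᵥ h)) *
      ψ (-(a ⬝ᵥ h)) := by
  classical
  have card_ne_zero : (Fintype.card R : ℂ) ^ Fintype.card ι ≠ 0 :=
    pow_ne_zero _ (Nat.cast_ne_zero.2 Fintype.card_ne_zero)
  have orthogonality (b : ι → R) : ∑ h, ψ (b ⬝ᵥ h) * ψ (-(a ⬝ᵥ h)) =
      if b = a then (Fintype.card R : ℂ) ^ Fintype.card ι else 0 := by
    simp_rw [← AddChar.map_add_eq_mul, ← sub_eq_add_neg, ← sub_dotProduct,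
      dotProduct_comm (b - a), sum_addChar_dotProduct hψ, sub_eq_zero]
  simp_rw [mul_assoc, ← Finset.mul_sum, Finset.sum_mul]
  rw [Finset.sum_comm]
  simp_rw [mul_assoc, ← Finset.mul_sum, orthogonality, mul_ite, mul_zero, Fintype.sum_ite_eq']
  field_simp

end Fourier

section InitialSegments

/-- Vectors of `m` base-`n` digits, most significant digit first, as the numbers below `n ^ m`. -/
noncomputable def digitEquiv (n m : ℕ) [NeZero n] : (Fin m → ZMod n) ≃ Fin (n ^ m) :=
  (Equiv.arrowCongr Fin.revPerm (ZMod.finEquiv n).symm.toEquiv).trans finFunctionFinEquiv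

/-- The digit vectors of the numbers `0, …, k - 1`; it stands for the interval `[0, k / n ^ m)`. -/
noncomputable def initialSegment (n m k : ℕ) [NeZero n] : Finset (Fin m → ZMod n) :=
  {a | (digitEquiv n m a : ℕ) < k}

/-- The Fourier coefficients of the indicator function of `initialSegment n m k`. -/
noncomputable def segmentCoeff {n m : ℕ} [NeZero n] (k : ℕ) (h : Fin m → ZMod n) : ℂ :=
  ((n : ℂ) ^ m)⁻¹ * ∑ a ∈ initialSegment n m k, ZMod.stdAddChar (a ⬝ᵥ h)

variable {n m : ℕ} [NeZero n]

theorem finEquiv_symm_val (b : ZMod n) : ((ZMod.finEquiv n).symm b : ℕ) = b.val := by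
  obtain _ | k := n
  · exact absurd rfl (NeZero.ne 0)
  · rfl

theorem finEquiv_apply (i : Fin n) : ZMod.finEquiv n i = ((i : ℕ) : ZMod n) := by
  rw [← ZMod.natCast_zmod_val (ZMod.finEquiv n i), ← finEquiv_symm_val,
    RingEquiv.symm_apply_apply]

theorem digitEquiv_val (a : Fin m → ZMod n) :
    (digitEquiv n m a : ℕ) = ∑ l, (a l).val * n ^ (l.rev : ℕ) := by
  rw [← Equiv.sum_comp Fin.revPerm]
  simp [digitEquiv, finFunctionFinEquiv_apply_val, finEquiv_symm_val, Equiv.arrowCongr]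

theorem digitEquiv_cons (b : ZMod n) (a : Fin m → ZMod n) :
    (digitEquiv n (m + 1) (Fin.cons b a) : ℕ) = b.val * n ^ m + digitEquiv n m a := by
  simp_rw [digitEquiv_val, Fin.sum_univ_succ, Fin.cons_zero, Fin.cons_succ, Fin.rev_zero,
    Fin.rev_succ, Fin.val_last, Fin.val_castSucc]

theorem mem_initialSegment {k : ℕ} {a : Fin m → ZMod n} :
    a ∈ initialSegment n m k ↔ (digitEquiv n m a : ℕ) < k := by
  simp [initialSegment]

theorem card_initialSegment {k : ℕ} (hk : k ≤ n ^ m) : (initialSegment n m k).card = k := by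
  have values : (initialSegment n m k).card =
      (Finset.univ.filter fun i : Fin (n ^ m) => (i : ℕ) < k).card :=
    Finset.card_equiv (digitEquiv n m) fun a => by simp [mem_initialSegment]
  rw [values, Fin.card_filter_val_lt, min_eq_right hk]

theorem initialSegment_zero : initialSegment n m 0 = ∅ := by
  simp [initialSegment]

theorem initialSegment_eq_univ {k : ℕ} (hk : n ^ m ≤ k) : initialSegment n m k = Finset.univ :=
  Finset.filter_true_of_mem fun a _ => (digitEquiv n m a).isLt.trans_le hk

theorem sum_initialSegment_succ {M : Type*} [AddCommMonoid M] (k : ℕ)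
    (F : (Fin (m + 1) → ZMod n) → M) :
    ∑ a ∈ initialSegment n (m + 1) k, F a =
      ∑ b : ZMod n, ∑ a ∈ initialSegment n m (k - b.val * n ^ m), F (Fin.cons b a) := by
  simp_rw [initialSegment, Finset.sum_filter, Nat.lt_sub_iff_add_lt']
  rw [← (Fin.consEquiv fun _ => ZMod n).sum_comp, Fintype.sum_prod_type]
  simp_rw [Fin.consEquiv, Equiv.coe_fn_mk, digitEquiv_cons]

theorem segmentCoeff_zero {k : ℕ} (hk : k ≤ n ^ m) :
    segmentCoeff k (0 : Fin m → ZMod n) = (k : ℂ) / (n : ℂ) ^ m := by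
  simp [segmentCoeff, card_initialSegment hk, div_eq_inv_mul]

theorem indicator_initialSegment_eq_sum (k : ℕ) (a : Fin m → ZMod n) :
    (if a ∈ initialSegment n m k then (1 : ℂ) else 0) =
      ∑ h : Fin m → ZMod n, segmentCoeff k h * ZMod.stdAddChar (-(a ⬝ᵥ h)) := by
  rw [fourier_inversion (ZMod.isPrimitive_stdAddChar n)
    (fun b => if b ∈ initialSegment n m k then (1 : ℂ) else 0) a]
  simp [segmentCoeff, ite_mul]

end InitialSegments

section ExponentialSums

variable {n m : ℕ} [NeZero n]

theorem norm_geom_sum_stdAddChar_le {b : ZMod n} (hb : b ≠ 0) (t : ℕ) :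
    ‖∑ j ∈ Finset.range t, (ZMod.stdAddChar b : ℂ) ^ j‖ ≤
      1 / Real.sin (Real.pi / n * b.val) ^ 2 := by
  have hsin := sin_pi_div_mul_val_ne_zero hb
  set σ := Real.sin (Real.pi / n * b.val)
  have numerator : ‖(ZMod.stdAddChar b : ℂ) ^ t - 1‖ ≤ 2 := by
    refine (norm_sub_le _ _).trans_eq ?_
    rw [norm_pow, AddChar.norm_apply, one_pow, norm_one, one_add_one_eq_two]
  calc ‖∑ j ∈ Finset.range t, (ZMod.stdAddChar b : ℂ) ^ j‖
      = ‖(ZMod.stdAddChar b : ℂ) ^ t - 1‖ / (2 * |σ|) := by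
        rw [geom_sum_eq (stdAddChar_ne_one hb), norm_div, norm_stdAddChar_sub_one]
    _ ≤ 2 / (2 * |σ|) := by gcongr
    _ = |σ| / σ ^ 2 := by rw [← sq_abs]; field_simp
    _ ≤ 1 / σ ^ 2 := by gcongr; exact Real.abs_sin_le_one _

theorem norm_sum_val_mul_add_lt_le {b : ZMod n} (hb : b ≠ 0) {q : ℕ} (hq : 0 < q) (d k : ℕ) :
    ‖∑ c : ZMod n with c.val * q + d < k, (ZMod.stdAddChar (c * b) : ℂ)‖ ≤
      1 / Real.sin (Real.pi / n * b.val) ^ 2 := by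
  have is_segment (j : ℕ) : j * q + d < k ↔ j < (k - d) ⌈/⌉ q := by
    rw [← not_le (b := j), ceilDiv_le_iff_le_mul hq, mul_comm q, not_le, Nat.lt_sub_iff_add_lt]
  have as_range : ∑ c : ZMod n with c.val * q + d < k, (ZMod.stdAddChar (c * b) : ℂ) =
      ∑ j ∈ Finset.range (min ((k - d) ⌈/⌉ q) n), (ZMod.stdAddChar b : ℂ) ^ j := by
    simp_rw [Finset.sum_filter, stdAddChar_mul_eq_pow, is_segment]
    rw [sum_zmod_val fun j => if j < (k - d) ⌈/⌉ q then (ZMod.stdAddChar b : ℂ) ^ j else 0,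
      ← Finset.sum_filter]
    congr 1
    ext j
    simp [and_comm]
  rw [as_range]
  exact norm_geom_sum_stdAddChar_le hb _

theorem norm_sum_initialSegment_head_le {b : ZMod n} (hb : b ≠ 0) (k : ℕ) :
    ‖∑ a ∈ initialSegment n (m + 1) k, (ZMod.stdAddChar (a 0 * b) : ℂ)‖ ≤
      (n : ℝ) ^ m * (1 / Real.sin (Real.pi / n * b.val) ^ 2) := by
  have swap : ∑ a ∈ initialSegment n (m + 1) k, (ZMod.stdAddChar (a 0 * b) : ℂ) =
      ∑ a : Fin m → ZMod n, ∑ c : ZMod n with c.val * n ^ m + digitEquiv n m a < k,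
        (ZMod.stdAddChar (c * b) : ℂ) := by
    simp_rw [sum_initialSegment_succ, initialSegment, Finset.sum_filter,
      Nat.lt_sub_iff_add_lt', Fin.cons_zero]
    exact Finset.sum_comm
  rw [swap]
  refine (norm_sum_le_of_le _ fun a _ =>
    norm_sum_val_mul_add_lt_le hb (NeZero.pos _) _ _).trans_eq ?_
  simp [ZMod.card]

theorem norm_sum_le_of_subsingleton_support {ι E : Type*} [Fintype ι] [SeminormedAddCommGroup E]
    {f : ι → E} {B : ℝ} (hB : 0 ≤ B) (support : ∀ i j, f i ≠ 0 → f j ≠ 0 → i = j)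
    (hf : ∀ i, ‖f i‖ ≤ B) : ‖∑ i, f i‖ ≤ B := by
  by_cases hzero : ∀ i, f i = 0
  · simpa [hzero] using hB
  · obtain ⟨i, hi⟩ := not_forall.1 hzero
    rw [Fintype.sum_eq_single i fun j hj => by_contra fun h => hj (support j i h hi)]
    exact hf i

/- Given the leading digit `c`, the remaining digits run through an initial segment that is empty
or everything, where the sum vanishes, unless `c = k / n ^ m`. -/
theorem norm_sum_initialSegment_succ_le {h : Fin m → ZMod n} (hh : h ≠ 0) (b : ZMod n) {B : ℝ}
    (hB : ∀ k, ‖∑ a ∈ initialSegment n m k, (ZMod.stdAddChar (a ⬝ᵥ h) : ℂ)‖ ≤ B) (k : ℕ) :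
    ‖∑ a ∈ initialSegment n (m + 1) k, (ZMod.stdAddChar (a ⬝ᵥ Fin.cons b h) : ℂ)‖ ≤ B := by
  have vanishes (k : ℕ) (hk : k = 0 ∨ n ^ m ≤ k) :
      ∑ a ∈ initialSegment n m k, (ZMod.stdAddChar (a ⬝ᵥ h) : ℂ) = 0 := by
    rcases hk with rfl | hk
    · rw [initialSegment_zero, Finset.sum_empty]
    · rw [initialSegment_eq_univ hk, sum_addChar_dotProduct (ZMod.isPrimitive_stdAddChar n),
        if_neg hh]
  have leading_digit (c : ZMod n) (hc : ∑ a ∈ initialSegment n m (k - c.val * n ^ m),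
      (ZMod.stdAddChar (a ⬝ᵥ h) : ℂ) ≠ 0) : c.val = k / n ^ m := by
    have := mt (vanishes _) hc
    push Not at this
    refine (Nat.div_eq_of_lt_le ?_ ?_).symm
    · omega
    · rw [Nat.succ_mul]
      omega
  have split_sum : ∑ a ∈ initialSegment n (m + 1) k, (ZMod.stdAddChar (a ⬝ᵥ Fin.cons b h) : ℂ) =
      ∑ c : ZMod n, ZMod.stdAddChar (c * b) *
        ∑ a ∈ initialSegment n m (k - c.val * n ^ m), (ZMod.stdAddChar (a ⬝ᵥ h) : ℂ) := by
    simp_rw [sum_initialSegment_succ, Finset.mul_sum, ← AddChar.map_add_eq_mul, dotProduct,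
      Fin.sum_univ_succ, Fin.cons_zero, Fin.cons_succ]
  rw [split_sum]
  refine norm_sum_le_of_subsingleton_support ((norm_nonneg _).trans (hB 0)) (fun c c' hc hc' => ?_)
    fun c => ?_
  · exact ZMod.val_injective n ((leading_digit c (right_ne_zero_of_mul hc)).trans
      (leading_digit c' (right_ne_zero_of_mul hc')).symm)
  · rw [norm_mul, AddChar.norm_apply, one_mul]
    exact hB _

end ExponentialSums

section PolynomialSums

variable {p m : ℕ} [Fact p.Prime]

theorem mem_polysLT {h : (ZMod p)[X]} : h ∈ polysLT p m ↔ h.degree < m := by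
  simp [polysLT]

theorem zero_mem_polysLT : (0 : (ZMod p)[X]) ∈ polysLT p m := by
  simp [mem_polysLT]

theorem ofFn_mem_polysLT (v : Fin m → ZMod p) : ofFn m v ∈ polysLT p m :=
  mem_polysLT.2 (ofFn_degree_lt v)

theorem ofFn_toFn {h : (ZMod p)[X]} (hh : h ∈ polysLT p m) : ofFn m (toFn m h) = h := by
  ext i
  obtain hi | hi := lt_or_ge i m
  · exact ofFn_coeff_eq_val_of_lt _ hi
  · rw [ofFn_coeff_eq_zero_of_ge _ hi, coeff_eq_zero_of_degree_lt
      ((mem_polysLT.1 hh).trans_le (Nat.cast_le.2 hi))]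

theorem toFn_eq_zero_iff {h : (ZMod p)[X]} (hh : h ∈ polysLT p m) : toFn m h = 0 ↔ h = 0 :=
  ⟨fun h0 => by rw [← ofFn_toFn hh, h0, ofFn_zero], fun h0 => by rw [h0, toFn_zero]⟩

theorem sum_polysLT {M : Type*} [AddCommMonoid M] (F : (ZMod p)[X] → M) :
    ∑ h ∈ polysLT p m, F h = ∑ v : Fin m → ZMod p, F (ofFn m v) :=
  (Finset.sum_bij' (fun v _ => ofFn m v) (fun h _ => toFn m h) (fun v _ => ofFn_mem_polysLT v)
    (fun _ _ => Finset.mem_univ _) (fun v _ => toFn_comp_ofFn_eq_id m v) (fun _ hh => ofFn_toFn hh)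
    (fun _ _ => rfl)).symm

theorem card_polysLT : (polysLT p m).card = p ^ m := by
  rw [Finset.card_eq_sum_ones, sum_polysLT]
  simp [ZMod.card]

theorem ofFn_cons (b : ZMod p) (v : Fin m → ZMod p) :
    ofFn (m + 1) (Fin.cons b v : Fin (m + 1) → ZMod p) = X * ofFn m v + C b := by
  simp_rw [ofFn_eq_sum_monomial, Fin.sum_univ_succ, Fin.cons_zero, Fin.cons_succ, Finset.mul_sum,
    Fin.val_zero, Fin.val_succ, X_mul_monomial, monomial_zero_left, add_comm (C b)]

theorem sum_polysLT_succ {M : Type*} [AddCommMonoid M] (F : (ZMod p)[X] → M) :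
    ∑ h ∈ polysLT p (m + 1), F h = ∑ q ∈ polysLT p m, ∑ b, F (X * q + C b) := by
  rw [sum_polysLT, sum_polysLT, ← (Fin.consEquiv fun _ => ZMod p).sum_comp,
    Fintype.sum_prod_type, Finset.sum_comm]
  simp_rw [Fin.consEquiv, Equiv.coe_fn_mk, ofFn_cons]

theorem rp_zero : rp p 0 = 0 := by
  simp [rp]

theorem rp_nonneg (h : (ZMod p)[X]) : 0 ≤ rp p h := by
  unfold rp
  positivity

theorem rp_C (b : ZMod p) :
    rp p (C b) = 1 / p * (1 / Real.sin (Real.pi / p * b.val) ^ 2) := by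
  rw [rp, natDegree_C, zero_add, pow_one, leadingCoeff_C, one_div_mul_one_div]

theorem rp_X_mul_add_C {q : (ZMod p)[X]} (hq : q ≠ 0) (b : ZMod p) :
    rp p (X * q + C b) = rp p q / p := by
  have degree_lt : (C b).degree < (X * q).degree := by
    refine degree_C_le.trans_lt (lt_of_lt_of_le ?_ (degree_le_mul_left X hq))
    simp
  rw [rp, rp, leadingCoeff_add_of_degree_lt' degree_lt, natDegree_add_C, leadingCoeff_mul,
    leadingCoeff_X, one_mul, natDegree_X_mul hq, div_div, pow_succ _ (q.natDegree + 1)]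
  ring

theorem rp_X_pow_mul (e : ℕ) (q : (ZMod p)[X]) : rp p (X ^ e * q) = rp p q / p ^ e := by
  obtain rfl | hq := eq_or_ne q 0
  · simp [rp_zero]
  · rw [rp, rp, leadingCoeff_mul, leadingCoeff_X_pow, one_mul, natDegree_X_pow_mul e hq, div_div]
    ring

/-- The sum of `r_p` over the polynomials of degree less than `m`. -/
noncomputable def rpTotal (p m : ℕ) [Fact p.Prime] : ℝ := ∑ h ∈ polysLT p m, rp p h

theorem rpTotal_nonneg : 0 ≤ rpTotal p m :=
  Finset.sum_nonneg fun h _ => rp_nonneg h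

theorem sum_rp_C : ∑ b, rp p (C b) = ((p : ℝ) ^ 2 - 1) / (3 * p) := by
  rw [← Finset.sum_erase Finset.univ (a := (0 : ZMod p)) (by rw [C_0, rp_zero])]
  simp_rw [rp_C]
  rw [← Finset.mul_sum, sum_one_div_sin_sq, one_div_mul_eq_div, div_div]

theorem rpTotal_eq (p m : ℕ) [Fact p.Prime] : rpTotal p m = m * (((p : ℝ) ^ 2 - 1) / (3 * p)) := by
  induction m with
  | zero => simp [rpTotal, sum_polysLT, rp_zero]
  | succ m ih =>
    have constants_and_rest : rpTotal p (m + 1) = ∑ b, rp p (C b) + rpTotal p m := by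
      rw [rpTotal, sum_polysLT_succ, ← Finset.add_sum_erase _ _ zero_mem_polysLT, rpTotal,
        ← Finset.sum_erase (polysLT p m) rp_zero]
      congr 1
      · simp_rw [mul_zero, zero_add]
      · refine Finset.sum_congr rfl fun q hq => ?_
        simp_rw [rp_X_mul_add_C (Finset.ne_of_mem_erase hq)]
        rw [Finset.sum_const, Finset.card_univ, ZMod.card, nsmul_eq_mul,
          mul_div_cancel₀ _ (NeZero.ne (p : ℝ))]
    rw [constants_and_rest, sum_rp_C, ih]
    push_cast
    ring

theorem toFn_succ (h : (ZMod p)[X]) :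
    toFn (m + 1) h = (Fin.cons (h.coeff 0) (toFn m h.divX) : Fin (m + 1) → ZMod p) := by
  ext i
  cases i using Fin.cases
  · rfl
  · exact coeff_divX.symm

theorem divX_mem_polysLT {h : (ZMod p)[X]} (hh : h ∈ polysLT p (m + 1)) :
    h.divX ∈ polysLT p m := by
  rw [mem_polysLT, degree_lt_iff_coeff_zero] at hh ⊢
  intro i hi
  rw [coeff_divX, hh _ (by omega)]

theorem norm_sum_initialSegment_le {h : (ZMod p)[X]} (hh : h ∈ polysLT p m) (h0 : h ≠ 0) (k : ℕ) :
    ‖∑ a ∈ initialSegment p m k, (ZMod.stdAddChar (a ⬝ᵥ toFn m h) : ℂ)‖ ≤ p ^ m * rp p h := by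
  have hp : (p : ℝ) ≠ 0 := NeZero.ne _
  induction m generalizing h k with
  | zero => simp [mem_polysLT, h0] at hh
  | succ m ih =>
    have decomposition : X * h.divX + C (h.coeff 0) = h := X_mul_divX_add h
    rw [toFn_succ]
    obtain hq | hq := eq_or_ne h.divX 0
    · rw [hq, mul_zero, zero_add] at decomposition
      have hb : h.coeff 0 ≠ 0 := fun hb => h0 (by rw [← decomposition, hb, C_0])
      have dotProduct_eq (a : Fin (m + 1) → ZMod p) :
          a ⬝ᵥ Fin.cons (h.coeff 0) (toFn m h.divX) = a 0 * h.coeff 0 := by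
        simp [hq, dotProduct, Fin.sum_univ_succ]
      simp_rw [dotProduct_eq]
      refine (norm_sum_initialSegment_head_le hb k).trans_eq ?_
      conv_rhs => rw [← decomposition, rp_C]
      field_simp
      ring
    · refine (norm_sum_initialSegment_succ_le (mt (toFn_eq_zero_iff (divX_mem_polysLT hh)).1 hq)
        (h.coeff 0) (ih (divX_mem_polysLT hh) hq) k).trans_eq ?_
      conv_rhs => rw [← decomposition, rp_X_mul_add_C hq]
      rw [pow_succ, mul_assoc, mul_div_cancel₀ _ hp]

theorem norm_segmentCoeff_le {h : (ZMod p)[X]} (hh : h ∈ polysLT p m) (h0 : h ≠ 0) (k : ℕ) :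
    ‖segmentCoeff k (toFn m h)‖ ≤ rp p h := by
  have hp : (0 : ℝ) < (p : ℝ) ^ m := pow_pos (Nat.cast_pos.2 (NeZero.pos p)) m
  rw [segmentCoeff, norm_mul, norm_inv, norm_pow, Complex.norm_natCast, inv_mul_le_iff₀ hp]
  exact norm_sum_initialSegment_le hh h0 k

end PolynomialSums

section LaurentDigits

variable {p m : ℕ} [Fact p.Prime]

/-- The coefficients of `x⁻¹, …, x⁻ᵐ`, i.e. the digits that `phi p m` reads. -/
def fractionDigits (m : ℕ) (L : LaurentSeries (ZMod p)) : Fin m → ZMod p :=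
  fun l => L.coeff ((l : ℤ) + 1)

theorem phi_eq_digitEquiv_div (L : LaurentSeries (ZMod p)) :
    phi p m L = (digitEquiv p m (fractionDigits m L) : ℕ) / (p : ℝ) ^ m := by
  have hp : (p : ℝ) ≠ 0 := NeZero.ne _
  have shift : Finset.Icc 1 m = (Finset.range m).image (· + 1) := by
    ext l
    simp only [Finset.mem_Icc, Finset.mem_image, Finset.mem_range]
    exact ⟨fun h => ⟨l - 1, by omega, by omega⟩, by rintro ⟨i, hi, rfl⟩; omega⟩
  rw [phi, shift, Finset.sum_image (by simp), digitEquiv_val, ← Fin.sum_univ_eq_sum_range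
    fun i => ((L.coeff ((i + 1 : ℕ) : ℤ)).val : ℝ) / (p : ℝ) ^ (i + 1), Nat.cast_sum,
    Finset.sum_div]
  refine Finset.sum_congr rfl fun i _ => ?_
  rw [div_eq_div_iff (by positivity) (by positivity), Fin.val_rev, fractionDigits]
  push_cast
  rw [mul_assoc, ← pow_add, Nat.sub_add_cancel i.isLt]

theorem laurentAtInfty_monomial (k : ℕ) (c : ZMod p) :
    laurentAtInfty p (monomial k c) = HahnSeries.single (-(k : ℤ)) c := by
  rw [laurentAtInfty, aeval_monomial, HahnSeries.single_pow, HahnSeries.algebraMap_apply']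
  simp

theorem coeff_laurentAtInfty_mul (q : (ZMod p)[X]) (L : LaurentSeries (ZMod p)) (l : ℤ) :
    (laurentAtInfty p q * L).coeff l = q.sum fun k c => c * L.coeff (l + k) := by
  induction q using Polynomial.induction_on' with
  | add q r hq hr =>
    rw [map_add, add_mul, HahnSeries.coeff_add, hq, hr, sum_add_index] <;> simp [add_mul]
  | monomial k c =>
    rw [laurentAtInfty_monomial, HahnSeries.coeff_single_mul, sum_monomial_index _ _ (by simp),
      sub_neg_eq_add]

theorem coeff_one_laurentAtInfty_mul {h : (ZMod p)[X]} (hh : h ∈ polysLT p m)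
    (L : LaurentSeries (ZMod p)) :
    (laurentAtInfty p h * L).coeff 1 = fractionDigits m L ⬝ᵥ toFn m h := by
  rw [coeff_laurentAtInfty_mul, ← sum_fin _ (by simp) (mem_polysLT.1 hh)]
  exact Finset.sum_congr rfl fun k _ => by rw [mul_comm, add_comm]; rfl

theorem coeff_laurentAtInfty_of_pos (q : (ZMod p)[X]) {l : ℤ} (hl : 0 < l) :
    (laurentAtInfty p q).coeff l = 0 := by
  rw [← mul_one (laurentAtInfty p q), coeff_laurentAtInfty_mul]
  refine Finset.sum_eq_zero fun k _ => ?_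
  simp only [HahnSeries.coeff_one, if_neg (show l + k ≠ 0 by omega), mul_zero]

theorem coeff_laurentAtInfty_neg (q : (ZMod p)[X]) (k : ℕ) :
    (laurentAtInfty p q).coeff (-k) = q.coeff k := by
  rw [← mul_one (laurentAtInfty p q), coeff_laurentAtInfty_mul]
  simp only [HahnSeries.coeff_one, mul_ite, mul_one, mul_zero, neg_add_eq_zero, Nat.cast_inj]
  rw [sum_def, Finset.sum_ite_eq]
  simp +contextual

theorem laurentAtInfty_ne_zero {q : (ZMod p)[X]} (hq : q ≠ 0) : laurentAtInfty p q ≠ 0 := by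
  intro h
  have := coeff_laurentAtInfty_neg q q.natDegree
  rw [h, HahnSeries.coeff_zero] at this
  exact hq (leadingCoeff_eq_zero.1 this.symm)

theorem order_laurentAtInfty {q : (ZMod p)[X]} (hq : q ≠ 0) :
    (laurentAtInfty p q).order = -(q.natDegree : ℤ) := by
  apply le_antisymm
  · apply HahnSeries.order_le_of_coeff_ne_zero
    rw [coeff_laurentAtInfty_neg]
    exact leadingCoeff_ne_zero.2 hq
  · have hcoeff := mt HahnSeries.coeff_order_eq_zero.1 (laurentAtInfty_ne_zero hq)
    have nonpos : (laurentAtInfty p q).order ≤ 0 :=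
      not_lt.1 fun h => hcoeff (coeff_laurentAtInfty_of_pos q h)
    obtain ⟨k, hk⟩ := Int.eq_ofNat_of_zero_le (neg_nonneg.2 nonpos)
    rw [← neg_neg (laurentAtInfty p q).order, hk, coeff_laurentAtInfty_neg] at hcoeff
    have := le_natDegree_of_ne_zero hcoeff
    omega

/- If `f ∤ Q`, the remainder `r = Q % f` is nonzero, and the expansion of `r / f` starts at
`x^(deg r - deg f)`, which is one of `x⁻¹, …, x⁻ᵐ`. -/
theorem fractionDigits_div_eq_zero_iff {f : (ZMod p)[X]} (hf : f.degree = m) (Q : (ZMod p)[X]) :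
    fractionDigits m (laurentAtInfty p Q / laurentAtInfty p f) = 0 ↔ f ∣ Q := by
  have f_ne_zero : f ≠ 0 := by rintro rfl; simp at hf
  have F_ne_zero := laurentAtInfty_ne_zero f_ne_zero
  have remainder_digits :
      fractionDigits m (laurentAtInfty p Q / laurentAtInfty p f) =
        fractionDigits m (laurentAtInfty p (Q % f) / laurentAtInfty p f) := by
    conv_lhs => rw [← EuclideanDomain.mod_add_div Q f, map_add, map_mul, add_div,
      mul_div_cancel_left₀ _ F_ne_zero]
    ext l
    simp [fractionDigits, coeff_laurentAtInfty_of_pos (Q / f) (l := l + 1) (by omega)]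
  rw [remainder_digits, ← EuclideanDomain.mod_eq_zero]
  refine ⟨fun digits_zero => by_contra fun r_ne_zero => ?_, fun h => ?_⟩
  · have R_ne_zero := laurentAtInfty_ne_zero r_ne_zero
    have order_eq := HahnSeries.order_mul (div_ne_zero R_ne_zero F_ne_zero) F_ne_zero
    rw [div_mul_cancel₀ _ F_ne_zero, order_laurentAtInfty r_ne_zero,
      order_laurentAtInfty f_ne_zero, natDegree_eq_of_degree_eq_some hf] at order_eq
    have degree_lt : (Q % f).natDegree < m := by
      rw [natDegree_lt_iff_degree_lt r_ne_zero, ← hf]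
      exact EuclideanDomain.mod_lt Q f_ne_zero
    refine mt HahnSeries.coeff_order_eq_zero.1 (div_ne_zero R_ne_zero F_ne_zero) ?_
    have index : ((m - (Q % f).natDegree - 1 : ℕ) : ℤ) + 1 =
        (laurentAtInfty p (Q % f) / laurentAtInfty p f).order := by omega
    rw [← index]
    exact congrFun digits_zero ⟨m - (Q % f).natDegree - 1, by omega⟩
  · rw [h, map_zero, zero_div]
    rfl

theorem digitPoly_eq_ofFn (n : ℕ) :
    digitPoly p m n = ofFn m fun i : Fin m => ((n / p ^ (i : ℕ) % p : ℕ) : ZMod p) := by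
  rw [ofFn_eq_sum_monomial, digitPoly, ← Fin.sum_univ_eq_sum_range
    fun r => C ((n / p ^ r % p : ℕ) : ZMod p) * X ^ r]
  simp_rw [C_mul_X_pow_eq_monomial]

theorem sum_digitPoly {M : Type*} [AddCommMonoid M] (F : (ZMod p)[X] → M) :
    ∑ n : Fin (p ^ m), F (digitPoly p m n) = ∑ q ∈ polysLT p m, F q := by
  rw [sum_polysLT, ← (finFunctionFinEquiv.symm.trans
    (Equiv.arrowCongr (Equiv.refl (Fin m)) (ZMod.finEquiv p).toEquiv)).sum_comp]
  refine Finset.sum_congr rfl fun n _ => ?_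
  rw [digitPoly_eq_ofFn]
  congr 2
  ext i
  simp [finEquiv_apply, finFunctionFinEquiv_symm_apply_val]

end LaurentDigits

section DualNet

variable {p m d : ℕ} [Fact p.Prime]

/-- The dual net of the polynomial lattice generated by `g` modulo `f`, with all components of
degree less than `m`. -/
noncomputable def dualNet (m : ℕ) (g : Fin d → (ZMod p)[X]) (f : (ZMod p)[X]) :
    Finset (Fin d → (ZMod p)[X]) :=
  open Classical in {h ∈ Fintype.piFinset fun _ => polysLT p m | f ∣ ∑ i, h i * g i}

/-- The digits of the `i`-th coordinate of the lattice point with index polynomial `q`. -/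
noncomputable def pointDigits (m : ℕ) (g : Fin d → (ZMod p)[X]) (f q : (ZMod p)[X]) (i : Fin d) :
    Fin m → ZMod p :=
  fractionDigits m (laurentAtInfty p (q * g i) / laurentAtInfty p f)

variable {g : Fin d → (ZMod p)[X]} {f : (ZMod p)[X]}

theorem mem_dualNet {h : Fin d → (ZMod p)[X]} :
    h ∈ dualNet m g f ↔ (∀ i, h i ∈ polysLT p m) ∧ f ∣ ∑ i, h i * g i := by
  simp [dualNet]

theorem zero_mem_dualNet : 0 ∈ dualNet m g f := by
  simp [mem_dualNet, zero_mem_polysLT]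

theorem figureR_eq_sum_erase (γ : ℕ → ℝ) :
    figureR p m γ g f = ∑ h ∈ (dualNet m g f).erase 0, ∏ i, rpWeighted p (h i) (γ i) := by
  rw [figureR]
  congr 1
  ext h
  simp only [Finset.mem_filter, Finset.mem_erase, mem_dualNet, Fintype.mem_piFinset]
  tauto

theorem latticePoints_apply (n : Fin (p ^ m)) (i : Fin d) :
    latticePoints p m g f n i =
      (digitEquiv p m (pointDigits m g f (digitPoly p m n) i) : ℕ) / ((p ^ m : ℕ) : ℝ) := by
  rw [latticePoints, phi_eq_digitEquiv_div, Nat.cast_pow, pointDigits]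

theorem sum_pointDigits_dotProduct {h : Fin d → (ZMod p)[X]} (hh : ∀ i, h i ∈ polysLT p m)
    {q : (ZMod p)[X]} (hq : q ∈ polysLT p m) :
    ∑ i, pointDigits m g f q i ⬝ᵥ toFn m (h i) =
      fractionDigits m (laurentAtInfty p (∑ i, h i * g i) / laurentAtInfty p f) ⬝ᵥ toFn m q := by
  simp_rw [pointDigits, ← coeff_one_laurentAtInfty_mul (hh _)]
  rw [← coeff_one_laurentAtInfty_mul hq, ← HahnSeries.coeff_sum]
  congr 1
  rw [map_sum, Finset.sum_div, Finset.mul_sum]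
  simp_rw [map_mul]
  exact Finset.sum_congr rfl fun i _ => by ring

theorem sum_prod_stdAddChar_pointDigits (hf : f.degree = m) {h : Fin d → (ZMod p)[X]}
    (hh : ∀ i, h i ∈ polysLT p m) [Decidable (f ∣ ∑ i, h i * g i)] :
    ∑ q ∈ polysLT p m, ∏ i, (ZMod.stdAddChar (-(pointDigits m g f q i ⬝ᵥ toFn m (h i))) : ℂ) =
      if f ∣ ∑ i, h i * g i then (p : ℂ) ^ m else 0 := by
  set D := fractionDigits m (laurentAtInfty p (∑ i, h i * g i) / laurentAtInfty p f)
  have as_character (q) (hq : q ∈ polysLT p m) :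
      ∏ i, (ZMod.stdAddChar (-(pointDigits m g f q i ⬝ᵥ toFn m (h i))) : ℂ) =
        ZMod.stdAddChar (toFn m q ⬝ᵥ (-D)) := by
    rw [← addChar_sum_eq_prod, Finset.sum_neg_distrib, sum_pointDigits_dotProduct hh hq,
      dotProduct_neg, dotProduct_comm]
  rw [Finset.sum_congr rfl as_character, sum_polysLT]
  simp_rw [toFn_comp_ofFn_eq_id, sum_addChar_dotProduct (ZMod.isPrimitive_stdAddChar p),
    neg_eq_zero, D, fractionDigits_div_eq_zero_iff hf, ZMod.card, Fintype.card_fin]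

theorem mean_prod_indicator_eq_sum_dualNet (hf : f.degree = m) (k : Fin d → ℕ) :
    ((p : ℂ) ^ m)⁻¹ * ∑ q ∈ polysLT p m,
        ∏ i, (if pointDigits m g f q i ∈ initialSegment p m (k i) then (1 : ℂ) else 0) =
      ∑ h ∈ dualNet m g f, ∏ i, segmentCoeff (k i) (toFn m (h i)) := by
  classical
  have hp : (p : ℂ) ^ m ≠ 0 := pow_ne_zero m (NeZero.ne _)
  have expansion (k : ℕ) (a : Fin m → ZMod p) :
      (if a ∈ initialSegment p m k then (1 : ℂ) else 0) =
        ∑ h ∈ polysLT p m, segmentCoeff k (toFn m h) * ZMod.stdAddChar (-(a ⬝ᵥ toFn m h)) := by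
    rw [indicator_initialSegment_eq_sum, sum_polysLT]
    simp_rw [toFn_comp_ofFn_eq_id]
  simp_rw [expansion, Finset.prod_univ_sum, Finset.prod_mul_distrib]
  rw [Finset.sum_comm, dualNet, Finset.sum_filter, Finset.mul_sum]
  refine Finset.sum_congr rfl fun h hh => ?_
  rw [← Finset.mul_sum, sum_prod_stdAddChar_pointDigits hf (Fintype.mem_piFinset.1 hh)]
  split_ifs
  · field_simp
  · simp

end DualNet

section GridDiscrepancy

variable {p m s : ℕ} [Fact p.Prime] {g : Fin s → (ZMod p)[X]} {f : (ZMod p)[X]} {γ : ℕ → ℝ}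

theorem localDiscrepancy_latticePoints_grid (hf : f.degree = m) {k : Fin s → ℕ}
    (hk : ∀ j, k j ≤ p ^ m) :
    (localDiscrepancy (latticePoints p m g f) fun j => k j / ((p ^ m : ℕ) : ℝ) : ℂ) =
      ∑ h ∈ (dualNet m g f).erase 0, ∏ j, segmentCoeff (k j) (toFn m (h j)) := by
  have hp : (0 : ℝ) < ((p ^ m : ℕ) : ℝ) := Nat.cast_pos.2 (NeZero.pos _)
  have indicator_eq (n : Fin (p ^ m)) :
      ((Set.indicator {y : Fin s → ℝ | ∀ j, 0 ≤ y j ∧ y j < k j / ((p ^ m : ℕ) : ℝ)}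
        (fun _ => (1 : ℝ)) (latticePoints p m g f n) : ℝ) : ℂ) =
      ∏ j, if pointDigits m g f (digitPoly p m n) j ∈ initialSegment p m (k j)
        then (1 : ℂ) else 0 := by
    have in_box (j) : (0 ≤ latticePoints p m g f n j ∧
        latticePoints p m g f n j < k j / ((p ^ m : ℕ) : ℝ)) ↔
        pointDigits m g f (digitPoly p m n) j ∈ initialSegment p m (k j) := by
      rw [latticePoints_apply, mem_initialSegment, div_lt_div_iff_of_pos_right hp, Nat.cast_lt]
      exact and_iff_right (by positivity)
    rw [Fintype.prod_ite_zero, Set.indicator_apply]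
    simp only [Set.mem_ofPred_eq, in_box, Finset.prod_const_one]
    split_ifs <;> simp
  have volume_eq : ∏ j, (k j / (p : ℂ) ^ m) =
      ∏ j, segmentCoeff (k j) (toFn m ((0 : Fin s → (ZMod p)[X]) j)) := by
    simp_rw [Pi.zero_apply, toFn_zero, segmentCoeff_zero (hk _)]
  rw [Finset.sum_erase_eq_sub zero_mem_dualNet, ← mean_prod_indicator_eq_sum_dualNet hf,
    ← volume_eq, ← sum_digitPoly, localDiscrepancy]
  push_cast
  simp_rw [← indicator_eq, one_div, Nat.cast_pow]

theorem rpWeighted_nonneg {c : ℝ} (hc : 0 ≤ c) (h : (ZMod p)[X]) : 0 ≤ rpWeighted p h c := by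
  rw [rpWeighted]
  split_ifs
  · positivity
  · exact mul_nonneg hc (rp_nonneg h)

theorem mul_norm_segmentCoeff_le_rpWeighted {c : ℝ} (hc : 0 ≤ c) {h : (ZMod p)[X]}
    (hh : h ∈ polysLT p m) {k : ℕ} (hk : k ≤ p ^ m) :
    c * ‖segmentCoeff k (toFn m h)‖ ≤ rpWeighted p h c := by
  rw [rpWeighted]
  split_ifs with h0
  · have hk' : (k : ℝ) / (p : ℝ) ^ m ≤ 1 := div_le_one_of_le₀ (by exact_mod_cast hk) (by positivity)
    rw [h0, toFn_zero, segmentCoeff_zero hk, norm_div, norm_pow, Complex.norm_natCast,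
      Complex.norm_natCast]
    nlinarith
  · exact mul_le_mul_of_nonneg_left (norm_segmentCoeff_le hh h0 k) hc

theorem norm_segmentCoeff_full_le_rpWeighted {c : ℝ} (hc : 0 ≤ c) {h : (ZMod p)[X]}
    (hh : h ∈ polysLT p m) : ‖segmentCoeff (p ^ m) (toFn m h)‖ ≤ rpWeighted p h c := by
  obtain rfl | h0 := eq_or_ne h 0
  · rw [toFn_zero, segmentCoeff_zero le_rfl, rpWeighted, if_pos rfl, Nat.cast_pow,
      div_self (pow_ne_zero m (NeZero.ne _)), norm_one]
    linarith
  · rw [segmentCoeff, initialSegment_eq_univ le_rfl,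
      sum_addChar_dotProduct (ZMod.isPrimitive_stdAddChar p),
      if_neg (mt (toFn_eq_zero_iff hh).1 h0), mul_zero, norm_zero]
    exact rpWeighted_nonneg hc h

theorem productWeight_nonneg (hγ : ∀ j, 0 ≤ γ j) (u : Finset (Fin s)) : 0 ≤ productWeight γ u :=
  Finset.prod_nonneg fun j _ => hγ j

theorem productWeight_mul_norm_prod_segmentCoeff_le (hγ : ∀ j, 0 ≤ γ j) {u : Finset (Fin s)}
    {k : Fin s → ℕ} (hk : ∀ j, k j ≤ p ^ m) (hku : ∀ j ∉ u, k j = p ^ m)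
    {h : Fin s → (ZMod p)[X]} (hh : ∀ j, h j ∈ polysLT p m) :
    productWeight γ u * ‖∏ j, segmentCoeff (k j) (toFn m (h j))‖ ≤
      ∏ j, rpWeighted p (h j) (γ j) := by
  have weight_eq : productWeight γ u = ∏ j, if j ∈ u then γ j else 1 := by
    rw [productWeight, Finset.prod_ite_mem, Finset.univ_inter]
  rw [weight_eq, norm_prod, ← Finset.prod_mul_distrib]
  refine Finset.prod_le_prod (fun j _ => ?_) fun j _ => ?_
  · have := hγ j
    positivity
  · split_ifs with hj
    · exact mul_norm_segmentCoeff_le_rpWeighted (hγ j) (hh j) (hk j)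
    · rw [one_mul, hku j hj]
      exact norm_segmentCoeff_full_le_rpWeighted (hγ j) (hh j)

theorem productWeight_mul_abs_localDiscrepancy_grid_le (hf : f.degree = m) (hγ : ∀ j, 0 ≤ γ j)
    {u : Finset (Fin s)} {k : Fin s → ℕ} (hk : ∀ j, k j ≤ p ^ m) (hku : ∀ j ∉ u, k j = p ^ m) :
    productWeight γ u *
        |localDiscrepancy (latticePoints p m g f) fun j => k j / ((p ^ m : ℕ) : ℝ)| ≤
      figureR p m γ g f := by
  rw [← Real.norm_eq_abs, ← Complex.norm_real, localDiscrepancy_latticePoints_grid hf hk,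
    figureR_eq_sum_erase]
  calc productWeight γ u * ‖∑ h ∈ (dualNet m g f).erase 0, ∏ j, segmentCoeff (k j) (toFn m (h j))‖
      ≤ productWeight γ u *
          ∑ h ∈ (dualNet m g f).erase 0, ‖∏ j, segmentCoeff (k j) (toFn m (h j))‖ :=
        mul_le_mul_of_nonneg_left (norm_sum_le _ _) (productWeight_nonneg hγ u)
    _ ≤ ∑ h ∈ (dualNet m g f).erase 0, ∏ j, rpWeighted p (h j) (γ j) := by
        rw [Finset.mul_sum]
        exact Finset.sum_le_sum fun h hh => productWeight_mul_norm_prod_segmentCoeff_le hγ hk hku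
          (mem_dualNet.1 (Finset.mem_of_mem_erase hh)).1

end GridDiscrepancy

section Rounding

theorem prod_sub_prod_le {ι : Type*} {u : Finset ι} {a b : ι → ℝ} {δ : ℝ} (hδ₀ : 0 ≤ δ)
    (hδ₁ : δ ≤ 1) (hb : ∀ i ∈ u, 0 ≤ b i) (hba : ∀ i ∈ u, b i ≤ a i)
    (hab : ∀ i ∈ u, a i ≤ b i + δ) (ha : ∀ i ∈ u, a i ≤ 1) :
    ∏ i ∈ u, a i - ∏ i ∈ u, b i ≤ 1 - (1 - δ) ^ u.card := by
  classical
  induction u using Finset.induction_on with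
  | empty => simp
  | insert i u hi ih =>
    simp only [Finset.mem_insert, forall_eq_or_imp] at hb hba hab ha
    rw [Finset.prod_insert hi, Finset.prod_insert hi, Finset.card_insert_of_notMem hi, pow_succ']
    set A := ∏ i ∈ u, a i
    set B := ∏ i ∈ u, b i
    have hB : 0 ≤ B := Finset.prod_nonneg hb.2
    have hBA : B ≤ A := Finset.prod_le_prod hb.2 hba.2
    have hA : A ≤ 1 := Finset.prod_le_one (fun i hi => (hb.2 i hi).trans (hba.2 i hi)) ha.2
    calc a i * A - b i * B = a i * (A - B) + (a i - b i) * B := by ring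
      _ ≤ 1 * (A - B) + δ * B :=
          add_le_add (mul_le_mul_of_nonneg_right ha.1 (sub_nonneg.2 hBA))
            (mul_le_mul_of_nonneg_right (sub_le_iff_le_add'.2 hab.1) hB)
      _ = δ * A + (1 - δ) * (A - B) := by ring
      _ ≤ δ * 1 + (1 - δ) * (1 - (1 - δ) ^ u.card) :=
          add_le_add (mul_le_mul_of_nonneg_left hA hδ₀)
            (mul_le_mul_of_nonneg_left (ih hb.2 hba.2 hab.2 ha.2) (sub_nonneg.2 hδ₁))
      _ = 1 - (1 - δ) * (1 - δ) ^ u.card := by ring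

theorem prod_fillOnes {s : ℕ} (u : Finset (Fin s)) (t : Fin s → ℝ) :
    ∏ j, fillOnes u t j = ∏ j ∈ u, t j := by
  simp_rw [fillOnes, Finset.prod_ite_mem, Finset.univ_inter]

/-- The smallest nonnegative multiple of `1 / M` that is at least `t`. -/
noncomputable def gridCeil (M : ℕ) (t : ℝ) : ℝ := ⌈t * M⌉₊ / M

variable {M N s : ℕ} {t : ℝ}

theorem le_gridCeil (hM : M ≠ 0) (t : ℝ) : t ≤ gridCeil M t :=
  (le_div_iff₀ (Nat.cast_pos.2 hM.pos)).2 (Nat.le_ceil _)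

theorem gridCeil_le_add (hM : M ≠ 0) (ht : 0 ≤ t) : gridCeil M t ≤ t + 1 / M := by
  have hM₀ : (0 : ℝ) < M := Nat.cast_pos.2 hM.pos
  rw [gridCeil, div_le_iff₀ hM₀, add_mul, div_mul_cancel₀ _ hM₀.ne']
  exact (Nat.ceil_lt_add_one (by positivity)).le

theorem ceil_mul_le (ht : t ≤ 1) : ⌈t * M⌉₊ ≤ M :=
  Nat.ceil_le.2 (mul_le_of_le_one_left M.cast_nonneg ht)

theorem gridCeil_le_one (ht : t ≤ 1) : gridCeil M t ≤ 1 :=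
  div_le_one_of_le₀ (Nat.cast_le.2 (ceil_mul_le ht)) M.cast_nonneg

theorem gridCeil_one (hM : M ≠ 0) : gridCeil M 1 = 1 := by
  rw [gridCeil, one_mul, Nat.ceil_natCast, div_self (Nat.cast_ne_zero.2 hM)]

theorem gridCeil_fillOnes (hM : M ≠ 0) (u : Finset (Fin s)) (t : Fin s → ℝ) (j : Fin s) :
    gridCeil M (fillOnes u t j) = fillOnes u (fun j => gridCeil M (t j)) j := by
  rw [fillOnes, fillOnes, apply_ite (gridCeil M), gridCeil_one hM]

theorem natCast_div_lt_gridCeil_iff (hM : M ≠ 0) (a : ℕ) :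
    (a : ℝ) / M < gridCeil M t ↔ (a : ℝ) / M < t := by
  have hM₀ : (0 : ℝ) < M := Nat.cast_pos.2 hM.pos
  rw [gridCeil, div_lt_div_iff_of_pos_right hM₀, Nat.cast_lt, Nat.lt_ceil, div_lt_iff₀ hM₀]

/-- Moving the corner of a box up to the grid `ℤ / M` changes its volume, but not the number of
grid points in it. -/
theorem localDiscrepancy_eq_add_volume_gridCeil (hM : M ≠ 0) {x : Fin N → Fin s → ℝ}
    (hx : ∀ n j, ∃ a : ℕ, x n j = a / M) (t : Fin s → ℝ) :
    localDiscrepancy x t = localDiscrepancy x (fun j => gridCeil M (t j)) +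
      (∏ j, gridCeil M (t j) - ∏ j, t j) := by
  have same_points (n) : (∀ j, 0 ≤ x n j ∧ x n j < gridCeil M (t j)) ↔
      ∀ j, 0 ≤ x n j ∧ x n j < t j := by
    refine forall_congr' fun j => and_congr_right fun _ => ?_
    obtain ⟨a, ha⟩ := hx n j
    rw [ha, natCast_div_lt_gridCeil_iff hM]
  simp_rw [localDiscrepancy, Set.indicator_apply, Set.mem_ofPred_eq, same_points]
  ring

theorem abs_localDiscrepancy_fillOnes_le (hM : M ≠ 0) {x : Fin N → Fin s → ℝ}
    (hx : ∀ n j, ∃ a : ℕ, x n j = a / M) (u : Finset (Fin s)) {t : Fin s → ℝ}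
    (ht₀ : ∀ j, 0 ≤ t j) (ht₁ : ∀ j, t j ≤ 1) :
    |localDiscrepancy x (fillOnes u t)| ≤
      |localDiscrepancy x fun j => gridCeil M (fillOnes u t j)| +
        (1 - (1 - 1 / (M : ℝ)) ^ u.card) := by
  have volume_change : |∏ j, gridCeil M (fillOnes u t j) - ∏ j, fillOnes u t j| ≤
      1 - (1 - 1 / (M : ℝ)) ^ u.card := by
    simp_rw [gridCeil_fillOnes hM, prod_fillOnes]
    rw [abs_of_nonneg (sub_nonneg.2 (Finset.prod_le_prod (fun j _ => ht₀ j)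
      fun j _ => le_gridCeil hM (t j)))]
    exact prod_sub_prod_le (by positivity)
      (div_le_one_of_le₀ (Nat.one_le_cast.2 hM.pos) M.cast_nonneg) (fun j _ => ht₀ j)
      (fun j _ => le_gridCeil hM (t j)) (fun j _ => gridCeil_le_add hM (ht₀ j))
      fun j _ => gridCeil_le_one (ht₁ j)
  rw [localDiscrepancy_eq_add_volume_gridCeil hM hx]
  exact (abs_add_le _ _).trans (add_le_add_right volume_change _)

end Rounding

section StarDiscrepancy

variable {p m s : ℕ} [Fact p.Prime] {g : Fin s → (ZMod p)[X]} {f : (ZMod p)[X]} {γ : ℕ → ℝ}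

theorem productWeight_mul_abs_localDiscrepancy_le (hf : f.degree = m) (hγ : ∀ j, 0 ≤ γ j)
    (u : Finset (Fin s)) {t : Fin s → ℝ} (ht₀ : ∀ j, 0 ≤ t j) (ht₁ : ∀ j, t j ≤ 1) :
    productWeight γ u * |localDiscrepancy (latticePoints p m g f) (fillOnes u t)| ≤
      productWeight γ u * (1 - (1 - 1 / (p : ℝ) ^ m) ^ u.card) + figureR p m γ g f := by
  have hM : p ^ m ≠ 0 := NeZero.ne _
  have on_grid : productWeight γ u * |localDiscrepancy (latticePoints p m g f) fun j =>
      gridCeil (p ^ m) (fillOnes u t j)| ≤ figureR p m γ g f := by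
    refine productWeight_mul_abs_localDiscrepancy_grid_le hf hγ (fun j => ceil_mul_le ?_)
      fun j hj => ?_
    · rw [fillOnes]
      split_ifs
      exacts [ht₁ j, le_rfl]
    · rw [fillOnes, if_neg hj, one_mul, Nat.ceil_natCast]
  have rounding := abs_localDiscrepancy_fillOnes_le hM
    (fun n j => ⟨_, latticePoints_apply (g := g) (f := f) n j⟩) u ht₀ ht₁
  rw [Nat.cast_pow] at rounding
  calc productWeight γ u * |localDiscrepancy (latticePoints p m g f) (fillOnes u t)|
      ≤ _ := mul_le_mul_of_nonneg_left rounding (productWeight_nonneg hγ u)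
    _ ≤ _ := by rw [mul_add, add_comm]; exact add_le_add_right on_grid _

theorem weightedStarDiscrepancy_latticePoints_le (hs : 1 ≤ s) (hf : f.degree = m)
    (hγ : ∀ j, 0 ≤ γ j) :
    weightedStarDiscrepancy (productWeight γ) (latticePoints p m g f) ≤
      ∑ u ∈ (Finset.univ : Finset (Finset (Fin s))) with u.Nonempty,
        productWeight γ u * (1 - (1 - 1 / (p : ℝ) ^ m) ^ u.card) + figureR p m γ g f := by
  have one_div_le : 1 / (p : ℝ) ^ m ≤ 1 :=
    div_le_one_of_le₀ (by exact_mod_cast NeZero.pos (p ^ m)) (by positivity)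
  refine csSup_le ⟨_, fun _ => 1, fun _ => by norm_num, {⟨0, hs⟩}, by simp, rfl⟩ ?_
  rintro _ ⟨t, ht, u, hu, rfl⟩
  refine (productWeight_mul_abs_localDiscrepancy_le hf hγ u (fun j => (ht j).1.le)
    fun j => (ht j).2).trans (add_le_add_left ?_ _)
  refine Finset.single_le_sum (f := fun u => productWeight γ u *
    (1 - (1 - 1 / (p : ℝ) ^ m) ^ u.card)) (fun v _ => ?_) (by simpa using hu)
  exact mul_nonneg (productWeight_nonneg hγ v) (sub_nonneg.2
    (pow_le_one₀ (sub_nonneg.2 one_div_le) (sub_le_self _ (by positivity))))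

end StarDiscrepancy

section Congruences

variable {p m n e : ℕ} [Fact p.Prime] {c b : (ZMod p)[X]}

/-- The polynomials of degree less than `n` with nonzero constant coefficient, representing the
units modulo `X ^ n`. -/
noncomputable def unitsLT (p n : ℕ) [Fact p.Prime] : Finset (ZMod p)[X] :=
  {q ∈ polysLT p n | q.coeff 0 ≠ 0}

theorem mem_unitsLT {q : (ZMod p)[X]} : q ∈ unitsLT p n ↔ q ∈ polysLT p n ∧ ¬ X ∣ q := by
  rw [unitsLT, Finset.mem_filter, X_dvd_iff]

theorem card_unitsLT_succ : (unitsLT p (n + 1)).card = p ^ n * (p - 1) := by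
  rw [unitsLT, Finset.card_filter, sum_polysLT_succ]
  simp_rw [coeff_add, mul_coeff_zero, coeff_X_zero, zero_mul, coeff_C_zero, zero_add]
  rw [Finset.sum_const, card_polysLT, ← Finset.card_filter, Finset.filter_ne',
    Finset.card_erase_of_mem (Finset.mem_univ _), Finset.card_univ, ZMod.card, smul_eq_mul]

theorem pow_le_two_mul_card_unitsLT (hn : n ≠ 0) : p ^ n ≤ 2 * (unitsLT p n).card := by
  obtain ⟨n, rfl⟩ := Nat.exists_eq_succ_of_ne_zero hn
  have hp : p ≤ 2 * (p - 1) := by have := (Fact.out : p.Prime).two_le; omega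
  calc p ^ (n + 1) = p ^ n * p := pow_succ p n
    _ ≤ p ^ n * (2 * (p - 1)) := Nat.mul_le_mul_left _ hp
    _ = 2 * (unitsLT p (n + 1)).card := by rw [card_unitsLT_succ]; ring

theorem card_le_pow_of_X_pow_dvd_sub (he : e ≤ n) {S : Finset (ZMod p)[X]} (hS : S ⊆ polysLT p n)
    (hd : ∀ q ∈ S, ∀ q' ∈ S, X ^ (n - e) ∣ q - q') : S.card ≤ p ^ e := by
  have card_top : (Finset.univ : Finset (Fin e → ZMod p)).card = p ^ e := by simp [ZMod.card]
  rw [← card_top]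
  refine Finset.card_le_card_of_injOn (fun q i => q.coeff (n - e + i)) (by simp) ?_
  intro q hq q' hq' same_top
  ext k
  obtain hk | hk := lt_or_ge k (n - e)
  · exact sub_eq_zero.1 (by rw [← coeff_sub, X_pow_dvd_iff.1 (hd q hq q' hq') k hk])
  obtain hkn | hkn := lt_or_ge k n
  · simpa only [Nat.add_sub_of_le hk] using congrFun same_top ⟨k - (n - e), by omega⟩
  · rw [(degree_lt_iff_coeff_zero _ _).1 (mem_polysLT.1 (hS hq)) k hkn,
      (degree_lt_iff_coeff_zero _ _).1 (mem_polysLT.1 (hS hq')) k hkn]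

theorem exists_exact_X_pow_dvd (n : ℕ) (c : (ZMod p)[X]) :
    ∃ e ≤ n, X ^ e ∣ c ∧ (e < n → ¬ X ^ (e + 1) ∣ c) := by
  classical
  exact ⟨Nat.findGreatest (X ^ · ∣ c) n, Nat.findGreatest_le n,
    Nat.findGreatest_spec (P := (X ^ · ∣ c)) n.zero_le (by simp),
    fun he => Nat.findGreatest_is_greatest (Nat.lt_succ_self _) he⟩

open Classical in
/-- Here `X ^ e = gcd(c, X ^ n)`. A solution forces `X ^ e` to divide `b` exactly, unless `e = n`,
and then the congruence determines `q` modulo `X ^ (n - e)`. -/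
theorem card_unitsLT_filter_le (he : e ≤ n) (hc : X ^ e ∣ c) (hc' : e < n → ¬ X ^ (e + 1) ∣ c)
    (b : (ZMod p)[X]) :
    {q ∈ unitsLT p n | X ^ n ∣ c + b * q}.card ≤ if X ^ e ∣ b then p ^ e else 0 := by
  set S := {q ∈ unitsLT p n | X ^ n ∣ c + b * q}
  have mem_S {q} (hq : q ∈ S) : q ∈ polysLT p n ∧ ¬ X ∣ q ∧ X ^ n ∣ c + b * q := by
    rwa [Finset.mem_filter, mem_unitsLT, and_assoc] at hq
  obtain hS | ⟨q₀, hq₀⟩ := S.eq_empty_or_nonempty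
  · simp [hS]
  obtain ⟨-, hq₀_unit, hq₀_sol⟩ := mem_S hq₀
  have b_dvd : X ^ e ∣ b := prime_X.pow_dvd_of_dvd_mul_right e hq₀_unit
    ((dvd_add_right hc).1 ((pow_dvd_pow X he).trans hq₀_sol))
  rw [if_pos b_dvd]
  refine card_le_pow_of_X_pow_dvd_sub he (fun q hq => (mem_S hq).1) fun q hq q' hq' => ?_
  obtain rfl | hen := he.eq_or_lt
  · simp
  have b_exact : ¬ X ^ (e + 1) ∣ b := fun hb => hc' hen
    ((dvd_add_left (hb.mul_right q₀)).1 ((pow_dvd_pow X hen).trans hq₀_sol))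
  obtain ⟨b₁, rfl⟩ := b_dvd
  have b₁_unit : ¬ X ∣ b₁ := fun h => b_exact (by rw [pow_succ]; exact mul_dvd_mul_left _ h)
  refine prime_X.pow_dvd_of_dvd_mul_left _ b₁_unit
    ((mul_dvd_mul_iff_left (pow_ne_zero e (X_ne_zero (R := ZMod p)))).1 ?_)
  rw [← pow_add, Nat.add_sub_of_le he]
  convert dvd_sub (mem_S hq).2.2 (mem_S hq').2.2 using 1
  ring

open Classical in
theorem pow_mul_sum_rp_X_pow_dvd_le :
    (p : ℝ) ^ e * ∑ b ∈ polysLT p m with X ^ e ∣ b, rp p b ≤ rpTotal p m := by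
  have hp : (0 : ℝ) < (p : ℝ) ^ e := pow_pos (Nat.cast_pos.2 (NeZero.pos p)) e
  have multiples : {b ∈ polysLT p m | X ^ e ∣ b} ⊆ (polysLT p m).image (X ^ e * ·) := by
    intro b hb
    obtain ⟨hb, q, rfl⟩ := Finset.mem_filter.1 hb
    refine Finset.mem_image_of_mem _ (mem_polysLT.2 (lt_of_le_of_lt ?_ (mem_polysLT.1 hb)))
    rw [mul_comm]
    exact degree_le_mul_left q (pow_ne_zero e X_ne_zero)
  calc (p : ℝ) ^ e * ∑ b ∈ polysLT p m with X ^ e ∣ b, rp p b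
      ≤ (p : ℝ) ^ e * ∑ b ∈ (polysLT p m).image (X ^ e * ·), rp p b :=
        mul_le_mul_of_nonneg_left
          (Finset.sum_le_sum_of_subset_of_nonneg multiples fun b _ _ => rp_nonneg b) hp.le
    _ = (p : ℝ) ^ e * (rpTotal p m / p ^ e) := by
        rw [Finset.sum_image (mul_right_injective₀ (pow_ne_zero e X_ne_zero)).injOn]
        simp_rw [rp_X_pow_mul, ← Finset.sum_div, rpTotal]
    _ = rpTotal p m := mul_div_cancel₀ _ hp.ne'

open Classical in
theorem sum_unitsLT_sum_rp_le (m n : ℕ) (c : (ZMod p)[X]) :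
    ∑ q ∈ unitsLT p n, ∑ b ∈ polysLT p m with X ^ n ∣ c + b * q, rp p b ≤ rpTotal p m := by
  obtain ⟨e, he, hc, hc'⟩ := exists_exact_X_pow_dvd n c
  refine le_trans ?_ (pow_mul_sum_rp_X_pow_dvd_le (e := e))
  simp_rw [Finset.sum_filter]
  rw [Finset.sum_comm, Finset.mul_sum]
  refine Finset.sum_le_sum fun b _ => ?_
  calc ∑ q ∈ unitsLT p n, (if X ^ n ∣ c + b * q then rp p b else 0)
      = {q ∈ unitsLT p n | X ^ n ∣ c + b * q}.card * rp p b := by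
        rw [← Finset.sum_filter, Finset.sum_const, nsmul_eq_mul]
    _ ≤ (if X ^ e ∣ b then p ^ e else 0 : ℕ) * rp p b :=
        mul_le_mul_of_nonneg_right (Nat.cast_le.2 (card_unitsLT_filter_le he hc hc' b))
          (rp_nonneg b)
    _ = p ^ e * if X ^ e ∣ b then rp p b else 0 := by split_ifs <;> simp

end Congruences

section SearchSet

variable {p m w : ℕ} [Fact p.Prime] {f : (ZMod p)[X]}

open Classical in
/-- `searchSet p m w f` as a finset, for averages over it. -/
noncomputable def searchFinset (p m w : ℕ) [Fact p.Prime] (f : (ZMod p)[X]) :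
    Finset (ZMod p)[X] :=
  if w < m then {q ∈ polysLT p (m - w) | IsCoprime q f} else {1}

theorem mem_searchFinset {q : (ZMod p)[X]} :
    q ∈ searchFinset p m w f ↔ q ∈ searchSet p m w f := by
  unfold searchFinset searchSet
  split_ifs <;> simp

theorem isCoprime_of_mem_searchSet {q : (ZMod p)[X]} (hq : q ∈ searchSet p m w f) :
    IsCoprime q f := by
  unfold searchSet at hq
  split_ifs at hq
  exacts [hq.2, hq ▸ isCoprime_one_left]

theorem searchFinset_X_pow_of_lt (hw : w < m) : searchFinset p m w (X ^ m) = unitsLT p (m - w) := by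
  classical
  ext q
  rw [searchFinset, if_pos hw, Finset.mem_filter, mem_unitsLT,
    IsCoprime.pow_right_iff (Nat.zero_lt_of_lt hw), isCoprime_comm,
    irreducible_X.coprime_iff_not_dvd]

theorem searchFinset_of_le (hw : m ≤ w) : searchFinset p m w f = {1} :=
  if_neg hw.not_gt

theorem pow_le_two_mul_card_searchFinset (p m w : ℕ) [Fact p.Prime] :
    p ^ (m - w) ≤ 2 * (searchFinset p m w (X ^ m)).card := by
  obtain hw | hw := lt_or_ge w m
  · rw [searchFinset_X_pow_of_lt hw]
    exact pow_le_two_mul_card_unitsLT (by omega)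
  · simp [searchFinset_of_le hw, Nat.sub_eq_zero_of_le hw]

open Classical in
theorem sum_searchFinset_sum_rp_le (m w : ℕ) (c : (ZMod p)[X]) :
    ∑ q ∈ searchFinset p m w (X ^ m),
        ∑ b ∈ polysLT p m with X ^ m ∣ c + b * (X ^ w * q), rp p b ≤ rpTotal p m := by
  obtain hw | hw := lt_or_ge w m
  · rw [searchFinset_X_pow_of_lt hw]
    have X_pow_split : (X : (ZMod p)[X]) ^ m = X ^ w * X ^ (m - w) := by
      rw [← pow_add, Nat.add_sub_of_le hw.le]
    by_cases hc : X ^ w ∣ c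
    · obtain ⟨c, rfl⟩ := hc
      refine le_trans (le_of_eq ?_) (sum_unitsLT_sum_rp_le m (m - w) c)
      simp_rw [X_pow_split, mul_left_comm _ (X ^ w), ← mul_add,
        mul_dvd_mul_iff_left (pow_ne_zero w (X_ne_zero (R := ZMod p)))]
    · have no_solution (q b : (ZMod p)[X]) : ¬ X ^ m ∣ c + b * (X ^ w * q) := fun h =>
        hc ((dvd_add_left (dvd_mul_of_dvd_right (dvd_mul_right _ q) b)).1
          ((pow_dvd_pow X hw.le).trans h))
      simp only [no_solution, Finset.filter_false, Finset.sum_empty, Finset.sum_const_zero]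
      exact rpTotal_nonneg
  · rw [searchFinset_of_le hw, Finset.sum_singleton]
    exact Finset.sum_le_sum_of_subset_of_nonneg (Finset.filter_subset _ _) fun b _ _ => rp_nonneg b

end SearchSet

section ComponentByComponent

variable {p m d s : ℕ} [Fact p.Prime] {γ : ℕ → ℝ} {w : ℕ → ℕ} {f : (ZMod p)[X]}

theorem rpWeighted_eq_add [DecidableEq (ZMod p)[X]] (h : (ZMod p)[X]) (c : ℝ) :
    rpWeighted p h c = (if h = 0 then 1 + c else 0) + c * rp p h := by
  rw [rpWeighted]
  split_ifs with h0 <;> simp [h0, rp_zero]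

theorem sum_rpWeighted (c : ℝ) :
    ∑ h ∈ polysLT p m, rpWeighted p h c = 1 + c + c * rpTotal p m := by
  classical
  simp_rw [rpWeighted_eq_add, Finset.sum_add_distrib, ← Finset.mul_sum, rpTotal,
    Finset.sum_ite_eq', zero_mem_polysLT, if_true]

theorem sum_prod_rpWeighted (γ : ℕ → ℝ) (d : ℕ) :
    ∑ h ∈ Fintype.piFinset fun _ : Fin d => polysLT p m, ∏ i, rpWeighted p (h i) (γ i) =
      ∏ i : Fin d, (1 + γ i + γ i * rpTotal p m) := by
  simp_rw [← sum_rpWeighted]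
  exact Finset.sum_prod_piFinset (polysLT p m) fun (i : Fin d) h => rpWeighted p h (γ i)

theorem sum_dualNet_prod_rpWeighted (γ : ℕ → ℝ) (g : Fin d → (ZMod p)[X]) (f : (ZMod p)[X]) :
    ∑ h ∈ dualNet m g f, ∏ i, rpWeighted p (h i) (γ i) =
      ∏ i : Fin d, (1 + γ i) + figureR p m γ g f := by
  rw [figureR_eq_sum_erase, ← Finset.add_sum_erase _ _ zero_mem_dualNet]
  simp [rpWeighted]

open Classical in
theorem sum_dualNet_snoc {M : Type*} [AddCommMonoid M] (g : Fin d → (ZMod p)[X])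
    (y f : (ZMod p)[X]) (F : (Fin (d + 1) → (ZMod p)[X]) → M) :
    ∑ h ∈ dualNet m (Fin.snoc g y : Fin (d + 1) → (ZMod p)[X]) f, F h =
      ∑ h ∈ Fintype.piFinset fun _ : Fin d => polysLT p m,
        ∑ b ∈ polysLT p m with f ∣ ∑ i, h i * g i + b * y, F (Fin.snoc h b) := by
  rw [Finset.sum_sigma']
  refine Finset.sum_bij' (fun h _ => ⟨Fin.init h, h (Fin.last d)⟩) (fun x _ => Fin.snoc x.1 x.2)
    (fun h hh => ?_) (fun x hx => ?_) (fun h _ => Fin.snoc_init_self h) (fun x _ => ?_)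
    fun h _ => congrArg F (Fin.snoc_init_self h).symm
  · rw [mem_dualNet, Fin.forall_fin_succ', Fin.sum_univ_castSucc] at hh
    simp_rw [Fin.snoc_castSucc, Fin.snoc_last] at hh
    exact Finset.mem_sigma.2 ⟨Fintype.mem_piFinset.2 hh.1.1, Finset.mem_filter.2 ⟨hh.1.2, hh.2⟩⟩
  · rw [Finset.mem_sigma, Fintype.mem_piFinset, Finset.mem_filter] at hx
    rw [mem_dualNet, Fin.forall_fin_succ', Fin.sum_univ_castSucc]
    simp_rw [Fin.snoc_castSucc, Fin.snoc_last]
    exact ⟨⟨hx.1, hx.2.1⟩, hx.2.2⟩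
  · simp

open Classical in
theorem figureR_snoc (m : ℕ) (γ : ℕ → ℝ) (g : Fin d → (ZMod p)[X]) (y f : (ZMod p)[X]) :
    figureR p m γ (Fin.snoc g y : Fin (d + 1) → (ZMod p)[X]) f =
      (1 + γ d) * figureR p m γ g f +
        γ d * ∑ h ∈ Fintype.piFinset fun _ : Fin d => polysLT p m,
          (∏ i, rpWeighted p (h i) (γ i)) *
            ∑ b ∈ polysLT p m with f ∣ ∑ i, h i * g i + b * y, rp p b := by
  have last_component (h : Fin d → (ZMod p)[X]) :
      ∑ b ∈ polysLT p m with f ∣ ∑ i, h i * g i + b * y, rpWeighted p b (γ d) =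
        (if f ∣ ∑ i, h i * g i then 1 + γ d else 0) +
          γ d * ∑ b ∈ polysLT p m with f ∣ ∑ i, h i * g i + b * y, rp p b := by
    simp_rw [rpWeighted_eq_add, Finset.sum_add_distrib, ← Finset.mul_sum, Finset.sum_ite_eq',
      Finset.mem_filter, zero_mem_polysLT, zero_mul, add_zero, true_and]
  refine add_left_cancel ((sum_dualNet_prod_rpWeighted γ _ f).symm.trans ?_)
  simp_rw [sum_dualNet_snoc, Fin.prod_univ_castSucc, Fin.snoc_castSucc, Fin.snoc_last,
    Fin.val_castSucc, Fin.val_last, ← Finset.mul_sum, last_component, mul_add, mul_ite, mul_zero,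
    Finset.sum_add_distrib, ← Finset.sum_filter, ← Finset.sum_mul]
  rw [← dualNet, sum_dualNet_prod_rpWeighted, Finset.mul_sum]
  simp_rw [mul_left_comm (γ d)]
  ring

theorem figureR_congr {g g' : Fin d → (ZMod p)[X]}
    (h_iff : ∀ h : Fin d → (ZMod p)[X], f ∣ ∑ i, h i * g i ↔ f ∣ ∑ i, h i * g' i) :
    figureR p m γ g f = figureR p m γ g' f := by
  have same_dual_net : dualNet m g f = dualNet m g' f := by
    ext h
    rw [mem_dualNet, mem_dualNet, h_iff]
  rw [figureR_eq_sum_erase, figureR_eq_sum_erase, same_dual_net]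

theorem shiftedVector_update (w : ℕ → ℕ) (g : Fin s → (ZMod p)[X]) (i : Fin s) (q : (ZMod p)[X]) :
    shiftedVector p w (Function.update g i q) =
      Function.update (shiftedVector p w g) i (X ^ w i * q) := by
  ext1 j
  obtain rfl | hj := eq_or_ne j i
  · simp [shiftedVector]
  · simp [shiftedVector, hj]

/-- For `d = 0`, where nothing is minimized, `q` is irrelevant because it is a unit modulo `f`. -/
theorem IsReducedCBC.figureR_take_succ_le_snoc {g : Fin s → (ZMod p)[X]}
    (hg : IsReducedCBC p m f w γ g) (hd : d < s) {q : (ZMod p)[X]}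
    (hq : q ∈ searchSet p m (w d) f) :
    figureR p m γ (Fin.take (d + 1) hd (shiftedVector p w g)) f ≤
      figureR p m γ (Fin.snoc (Fin.take d hd.le (shiftedVector p w g)) (X ^ w d * q) :
        Fin (d + 1) → (ZMod p)[X]) f := by
  obtain rfl | hd₀ := Nat.eq_zero_or_pos d
  · rw [Fin.take_succ_eq_snoc 0 hd]
    refine (figureR_congr fun h => ?_).le
    simp only [Fin.sum_univ_castSucc, Finset.univ_eq_empty, Finset.sum_empty, zero_add,
      Fin.snoc_last, shiftedVector, hg.first_eq_one ⟨0, hd⟩ rfl, mul_one, ← mul_assoc]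
    exact ⟨fun hf => hf.mul_right q, (isCoprime_of_mem_searchSet hq).symm.dvd_of_dvd_mul_right⟩
  · refine (hg.minimal d hd hd₀ q hq).trans_eq ?_
    rw [Fin.take_succ_eq_snoc d hd, shiftedVector_update,
      Fin.take_update_of_ge d hd.le _ ⟨d, hd⟩ le_rfl, Function.update_self]

theorem sum_searchFinset_figureR_snoc_le (hγ : ∀ j, 0 ≤ γ j) (g : Fin d → (ZMod p)[X]) (w : ℕ) :
    ∑ q ∈ searchFinset p m w (X ^ m),
        figureR p m γ (Fin.snoc g (X ^ w * q) : Fin (d + 1) → (ZMod p)[X]) (X ^ m) ≤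
      (searchFinset p m w (X ^ m)).card * ((1 + γ d) * figureR p m γ g (X ^ m)) +
        γ d * ((∏ i : Fin d, (1 + γ i + γ i * rpTotal p m)) * rpTotal p m) := by
  classical
  simp_rw [figureR_snoc, Finset.sum_add_distrib, Finset.sum_const, nsmul_eq_mul, ← Finset.mul_sum]
  refine add_le_add_right (mul_le_mul_of_nonneg_left ?_ (hγ d)) _
  rw [Finset.sum_comm, ← sum_prod_rpWeighted, Finset.sum_mul]
  refine Finset.sum_le_sum fun h _ => ?_
  rw [← Finset.mul_sum]
  exact mul_le_mul_of_nonneg_left (sum_searchFinset_sum_rp_le m w _)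
    (Finset.prod_nonneg fun i _ => rpWeighted_nonneg (hγ i) _)

theorem IsReducedCBC.figureR_take_succ_le {g : Fin s → (ZMod p)[X]}
    (hg : IsReducedCBC p m (X ^ m) w γ g) (hγ : ∀ j, 0 ≤ γ j) (hd : d < s) :
    figureR p m γ (Fin.take (d + 1) hd (shiftedVector p w g)) (X ^ m) ≤
      (1 + γ d) * figureR p m γ (Fin.take d hd.le (shiftedVector p w g)) (X ^ m) +
        γ d * ((∏ i : Fin d, (1 + γ i + γ i * rpTotal p m)) *
          (2 * rpTotal p m / p ^ (m - w d))) := by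
  set S := searchFinset p m (w d) (X ^ m)
  set R := figureR p m γ (Fin.take (d + 1) hd (shiftedVector p w g)) (X ^ m)
  set A := (1 + γ d) * figureR p m γ (Fin.take d hd.le (shiftedVector p w g)) (X ^ m)
  set B := γ d * ((∏ i : Fin d, (1 + γ i + γ i * rpTotal p m)) * rpTotal p m)
  have hp : (0 : ℝ) < (p : ℝ) ^ (m - w d) := pow_pos (Nat.cast_pos.2 (NeZero.pos p)) _
  have hB : 0 ≤ B := by
    have := rpTotal_nonneg (p := p) (m := m)
    exact mul_nonneg (hγ d) (mul_nonneg (Finset.prod_nonneg fun i _ => by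
      have := hγ i; positivity) this)
  have card_ge : (p : ℝ) ^ (m - w d) ≤ 2 * S.card := by
    exact_mod_cast pow_le_two_mul_card_searchFinset p m (w d)
  have card_pos : (0 : ℝ) < S.card := by linarith
  have min_le_average : S.card * R ≤ S.card * A + B := by
    refine le_trans ?_ (sum_searchFinset_figureR_snoc_le hγ _ (w d))
    rw [← nsmul_eq_mul]
    exact Finset.card_nsmul_le_sum _ _ _ fun q hq =>
      hg.figureR_take_succ_le_snoc hd (mem_searchFinset.1 hq)
  calc R ≤ A + B / S.card := by rwa [← mul_le_mul_iff_right₀ card_pos, mul_add,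
        mul_div_cancel₀ _ card_pos.ne']
    _ ≤ A + 2 * B / p ^ (m - w d) := by
        refine add_le_add_right ((div_le_div_iff₀ card_pos hp).2 ?_) A
        nlinarith
    _ = A + γ d * ((∏ i : Fin d, (1 + γ i + γ i * rpTotal p m)) *
          (2 * rpTotal p m / p ^ (m - w d))) := by ring

theorem figureR_eq_zero_of_isEmpty (g : Fin 0 → (ZMod p)[X]) : figureR p m γ g f = 0 := by
  rw [figureR_eq_sum_erase]
  exact Finset.sum_eq_zero fun h hh => absurd (Subsingleton.elim h 0) (Finset.ne_of_mem_erase hh)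

theorem IsReducedCBC.figureR_take_le {g : Fin s → (ZMod p)[X]}
    (hg : IsReducedCBC p m (X ^ m) w γ g) (hγ : ∀ j, 0 ≤ γ j) (hd : d ≤ s) :
    figureR p m γ (Fin.take d hd (shiftedVector p w g)) (X ^ m) ≤
      1 / (p : ℝ) ^ m *
        ∏ i : Fin d, (1 + γ i + γ i * (2 * (p : ℝ) ^ min (w i) m * rpTotal p m)) := by
  have hp : (1 : ℝ) ≤ p := by exact_mod_cast NeZero.pos p
  have hT : 0 ≤ rpTotal p m := rpTotal_nonneg
  induction d with
  | zero => rw [figureR_eq_zero_of_isEmpty]; simp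
  | succ d ih =>
    set T := rpTotal p m
    set B := ∏ i : Fin d, (1 + γ i + γ i * (2 * (p : ℝ) ^ min (w i) m * T))
    have hγd := hγ d
    have factors_le : ∏ i : Fin d, (1 + γ i + γ i * T) ≤ B := by
      refine Finset.prod_le_prod (fun i _ => ?_) fun i _ => ?_
      · have := hγ i
        positivity
      · have hpow : (1 : ℝ) ≤ 2 * (p : ℝ) ^ min (w i) m := by
          linarith [one_le_pow₀ hp (n := min (w i) m)]
        exact add_le_add_right
          (mul_le_mul_of_nonneg_left (le_mul_of_one_le_left hT hpow) (hγ i)) _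
    have shift_eq : 2 * T / (p : ℝ) ^ (m - w d) = 1 / (p : ℝ) ^ m * (2 * p ^ min (w d) m * T) := by
      have exponent : m = min (w d) m + (m - w d) := by omega
      nth_rewrite 2 [exponent]
      rw [pow_add]
      field_simp
    calc figureR p m γ (Fin.take (d + 1) hd (shiftedVector p w g)) (X ^ m)
        ≤ (1 + γ d) * (1 / (p : ℝ) ^ m * B) + γ d * (B * (2 * T / p ^ (m - w d))) :=
          (hg.figureR_take_succ_le hγ hd).trans (by gcongr; exact ih _)
      _ = 1 / (p : ℝ) ^ m * (B * (1 + γ d + γ d * (2 * (p : ℝ) ^ min (w d) m * T))) := by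
          rw [shift_eq]; ring
      _ = _ := by rw [Fin.prod_univ_castSucc]; simp only [Fin.val_castSucc, Fin.val_last, B]

end ComponentByComponent

end PolyLattice

theorem mainTheorem3_general (p : ℕ) [Fact p.Prime] (m s : ℕ) (hs : 1 ≤ s)
    (γ : ℕ → ℝ) (hγ : ∀ j, 0 ≤ γ j) (w : ℕ → ℕ) (g : Fin s → Polynomial (ZMod p))
    (hg : PolyLattice.IsReducedCBC p m (Polynomial.X ^ m) w γ g) :
    PolyLattice.weightedStarDiscrepancy (PolyLattice.productWeight γ)
        (PolyLattice.latticePoints p m (PolyLattice.shiftedVector p w g) (Polynomial.X ^ m)) ≤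
      (∑ u : Finset (Fin s) with u.Nonempty,
          PolyLattice.productWeight γ u * (1 - (1 - 1 / (p : ℝ) ^ m) ^ u.card)) +
        1 / (p : ℝ) ^ m *
          ∏ i : Fin s, (1 + γ i +
            γ i * 2 * (p : ℝ) ^ min (w i) m * m * (((p : ℝ) ^ 2 - 1) / (3 * p))) := by
  have discrepancy_le := PolyLattice.weightedStarDiscrepancy_latticePoints_le
    (g := PolyLattice.shiftedVector p w g) hs (Polynomial.degree_X_pow m) hγ
  have figure_le := hg.figureR_take_le hγ le_rfl
  rw [Fin.take_eq_self] at figure_le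
  simp_rw [PolyLattice.rpTotal_eq, ← mul_assoc] at figure_le
  exact discrepancy_le.trans (add_le_add_right figure_le _)

theorem mainTheorem3 (p : ℕ) [Fact p.Prime] (m s : ℕ) (hm : 1 ≤ m) (hs : 1 ≤ s)
    (γ : ℕ → ℝ) (hγ_pos : ∀ j, 0 < γ j) (hγ_le : ∀ j, γ j ≤ 1) (hγ_anti : Antitone γ)
    (w : ℕ → ℕ) (hw_zero : w 0 = 0) (hw_mono : Monotone w)
    (g : Fin s → Polynomial (ZMod p))
    (hg : PolyLattice.IsReducedCBC p m (Polynomial.X ^ m) w γ g) :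
    PolyLattice.weightedStarDiscrepancy (PolyLattice.productWeight γ)
        (PolyLattice.latticePoints p m (PolyLattice.shiftedVector p w g) (Polynomial.X ^ m)) ≤
      (∑ u : Finset (Fin s) with u.Nonempty,
          PolyLattice.productWeight γ u * (1 - (1 - 1 / (p : ℝ) ^ m) ^ u.card)) +
        1 / (p : ℝ) ^ m *
          ∏ i : Fin s, (1 + γ i +
            γ i * 2 * (p : ℝ) ^ min (w i) m * m * (((p : ℝ) ^ 2 - 1) / (3 * p))) :=
  mainTheorem3_general p m s hs γ (fun j => (hγ_pos j).le) w g hg
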